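/- Let $\mu_4$ be the law of $\sum_{k\ge1}a_k4^{-k}$, where the $a_k$ are independent and uniformly distributed on $\{0,2\}$ (equivalently, the unique Borel probability measure on $\mathbb R$ with $\int f\,d\mu_4=\frac12\int f(\frac x4)\,d\mu_4(x)+\frac12\int f(\frac{x+2}4)\,d\mu_4(x)$ for all $f\in C_c(\mathbb R)$). For $t\in\mathbb R$ let $e_t(x)=e^{2\pi i t x}$. A set $S\subset\mathbb R$ is a *spectrum* for $\mu_4$ if $\{e_t : t\in S\}$ is an orthonormal basis of $L^2(\mu_4)$. The *base 4 expansion* $d_0d_1d_2\dots$ of an integer $k$ is defined by $k_0=k$ and $k_n=d_n+4k_{n+1}$ with $d_n\in\{0,1,2,3\}$, $k_{n+1}\in\mathbb Z$. A *spectral labeling* $\mathcal L$ is a labeling of the edges of the complete infinite rooted binary tree with labels in $\{0,1,2,3\}$ such that the two edges that start from any vertex have labels of different parity, and from every vertex there starts an infinite (descending) path whose labels are eventually all $0$ or eventually all $3$. Let $\Lambda(\mathcal L)\subset\mathbb Z$ be the set of integers whose base 4 expansion is the sequence of labels along an infinite path from the root whose labels are eventually all $0$ or eventually all $3$. Two labelings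 are identified if an automorphism of the rooted binary tree carries one to the other. Suppose that sets $A_\emptyset$ and, inductively, $A_{a_0\dots a_{k-1}}$ for all words with $a_0\in A_\emptyset,\dots,a_{k-1}\in A_{a_0\dots a_{k-2}}$, are given, each of the form $\{0,a\}$ with $a\in\mathbb Z$ odd, where $a$ may vary from word to word. Put $$\Lambda=\Big\{\sum_{k=0}^n4^ka_k : n\ge0,\ a_0\in A_\emptyset,\dots,a_n\in A_{a_0\dots a_{n-1}}\Big\},$$ and let $\Lambda(A)$ be the set of integers $\lambda$ for which there is an infinite sequence $a_0a_1\dots$ with $a_0\in A_\emptyset$, $a_k\in A_{a_0\dots a_{k-1}}$ for all $k\ge1$, and $\sum_{k=0}^{n-1}a_k4^k\equiv\lambda\pmod{4^n}$ for all $n\ge0$. **Theorem.** (i) The exponentials $e_\lambda$, $\lambda\in\Lambda$, are mutually orthogonal in $L^2(\mu_4)$. There exists a spectral labeling $\mathcal L$ with $\Lambda\subset\Lambda(\mathcal L)$, and it is unique (up to the identification above). Moreover $\Lambda(\mathcal L)=\Lambda(A)$. (ii) If the sets $A_{a_0\dots a_{k-1}}$ are uniformly bounded, then $\Lambda(\mathcal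 L)$ is a spectrum for $\mu_4$. -/

import Mathlib

open MeasureTheory

noncomputable section

namespace CantorFour

/-! ## The measure and its exponentials -/

/-- The fair coin on `Bool`. -/
def coin : Measure Bool := (PMF.uniformOfFintype Bool).toMeasure

instance : IsProbabilityMeasure coin := by
  unfold coin; infer_instance

/-- The point `∑_{k ≥ 1} a_k / 4 ^ k` of the Cantor set `X₄`, where `a_k ∈ {0, 2}` is selected by
the `(k - 1)`-st term of a binary sequence. -/
def cantorPoint (b : ℕ → Bool) : ℝ := ∑' k : ℕ, (if b k then (2 : ℝ) else 0) / 4 ^ (k + 1)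

theorem summable_cantorPoint (b : ℕ → Bool) :
    Summable fun k : ℕ => (if b k then (2 : ℝ) else 0) / 4 ^ (k + 1) := by
  have hg : Summable fun k : ℕ => (2 : ℝ) * (1 / 4) ^ (k + 1) :=
    ((summable_nat_add_iff 1).2
      (summable_geometric_of_lt_one (by norm_num) (by norm_num : (1 / 4 : ℝ) < 1))).mul_left 2
  refine Summable.of_nonneg_of_le (fun k => ?_) (fun k => ?_) hg
  · split_ifs <;> positivity
  · rw [one_div, inv_pow, div_eq_mul_inv]
    gcongr
    split_ifs <;> norm_num

theorem measurable_cantorPoint : Measurable cantorPoint := by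
  refine measurable_of_tendsto_metrizable
    (f := fun n b => ∑ k ∈ Finset.range n, (if b k then (2 : ℝ) else 0) / 4 ^ (k + 1))
    (fun n => ?_) ?_
  · refine Finset.measurable_sum _ fun k _ => Measurable.div_const ?_ _
    exact (measurable_of_finite fun c : Bool => if c then (2 : ℝ) else 0).comp
      (measurable_pi_apply k)
  · rw [tendsto_pi_nhds]
    exact fun b => (summable_cantorPoint b).hasSum.tendsto_sum_nat

/-- The measure `μ₄` on `ℝ`: the law of `∑_{k ≥ 1} a_k / 4 ^ k`, where the digits `a_k` are
independent and uniformly distributed on `{0, 2}`. -/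
def mu4 : Measure ℝ := (Measure.infinitePi fun _ : ℕ => coin).map cantorPoint

instance : IsProbabilityMeasure mu4 :=
  Measure.isProbabilityMeasure_map measurable_cantorPoint.aemeasurable

/-- The exponential function `e_t(x) = exp (2 π i t x)`. -/
def expFun (t x : ℝ) : ℂ := Complex.exp (2 * Real.pi * Complex.I * t * x)

theorem norm_expFun (t x : ℝ) : ‖expFun t x‖ = 1 := by
  have h : expFun t x = Complex.exp (((2 * Real.pi * t * x : ℝ) : ℂ) * Complex.I) := by
    unfold expFun
    congr 1
    push_cast
    ring
  rw [h, Complex.norm_exp_ofReal_mul_I]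

theorem memLp_expFun (μ : Measure ℝ) [IsFiniteMeasure μ] (t : ℝ) : MemLp (expFun t) 2 μ := by
  refine MemLp.of_bound ?_ 1 (Filter.Eventually.of_forall fun x => (norm_expFun t x).le)
  have hc : Continuous (expFun t) := by
    unfold expFun
    fun_prop
  exact hc.aestronglyMeasurable

/-- The exponential `e_t` as an element of `L²(μ)`. -/
def expL2 (μ : Measure ℝ) [IsFiniteMeasure μ] (t : ℝ) : Lp ℂ 2 μ := (memLp_expFun μ t).toLp (expFun t)

/-- The exponentials `e_t`, `t ∈ S`, are mutually orthogonal in `L²(μ)`. -/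
def OrthogonalExponentials (μ : Measure ℝ) [IsFiniteMeasure μ] (S : Set ℝ) : Prop :=
  S.Pairwise fun s t => inner ℂ (expL2 μ s) (expL2 μ t) = 0

/-- `S` is a spectrum for `μ`: the exponentials `e_t`, `t ∈ S`, form an orthonormal basis of
`L²(μ)`. -/
def IsSpectrum (μ : Measure ℝ) [IsProbabilityMeasure μ] (S : Set ℝ) : Prop :=
  ∃ b : HilbertBasis S ℂ (Lp ℂ 2 μ), ∀ t : S, b t = expL2 μ t

/-! ## Base 4 expansions and spectral labelings -/

/-- The successive quotients `k_n` of the integer `k` under division by 4 with remainder. -/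
def base4Quot (k : ℤ) : ℕ → ℤ
  | 0 => k
  | n + 1 => base4Quot k n / 4

/-- The digit `d_n ∈ {0, 1, 2, 3}` of the base 4 expansion of the integer `k`, so that
`k_n = d_n + 4 * k_{n+1}`. -/
def base4Digit (k : ℤ) (n : ℕ) : ℤ := base4Quot k n % 4

/-- The word `s 0, s 1, …, s (n - 1)`. -/
def initialWord {α : Type*} (s : ℕ → α) (n : ℕ) : List α := (List.range n).map s

/-- A labeling of the edges of the complete infinite binary tree with labels in `{0, 1, 2, 3}`.
The vertices are the finite binary words (the root is the empty one), and `L v b` is the label of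
the edge from `v` to `v ++ [b]`. -/
abbrev Labeling : Type := List Bool → Bool → Fin 4

/-- The `n`-th label read along the infinite path that starts from the vertex `v` and whose
successive directions are `p 0, p 1, …`. -/
def Labeling.read (L : Labeling) (v : List Bool) (p : ℕ → Bool) (n : ℕ) : Fin 4 :=
  L (v ++ initialWord p n) (p n)

/-- An infinite word ends in `000…` or in `333…`. -/
def EndsInZerosOrThrees (ω : ℕ → Fin 4) : Prop :=
  (∃ N, ∀ n, N ≤ n → ω n = 0) ∨ (∃ N, ∀ n, N ≤ n → ω n = 3)

/-- Spectral labelings: the two edges that start from a vertex have labels of different parity, and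
from each vertex starts an infinite path whose edges are eventually all labeled `0` or eventually
all labeled `3`. -/
def IsSpectralLabeling (L : Labeling) : Prop :=
  (∀ v, (L v false).val % 2 ≠ (L v true).val % 2) ∧
    ∀ v, ∃ p : ℕ → Bool, EndsInZerosOrThrees (L.read v p)

/-- The set `Λ(L)` of the integers whose base 4 expansion is read along an infinite path from the
root that ends in `000…` or `333…`. -/
def Labeling.integers (L : Labeling) : Set ℤ :=
  {k | ∃ p : ℕ → Bool, EndsInZerosOrThrees (L.read [] p) ∧
    ∀ n, base4Digit k n = ((L.read [] p n).val : ℤ)}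

/-- Two labelings give the same labeled tree: some automorphism of the rooted binary tree carries
the labels of the first to the labels of the second. -/
def Labeling.SameTree (L L' : Labeling) : Prop :=
  ∃ φ : List Bool ≃ List Bool, φ [] = [] ∧
    ∀ v b, ∃ b', φ (v ++ [b]) = φ v ++ [b'] ∧ L' (φ v) b' = L v b

/-! ## Other digits

A system of digits is a function `A` that gives a set `A w` of integers for each finite word `w` of
integers; only its values at the words that are vertices matter. -/

/-- The word `a_0 … a_{k-1}` is a vertex of the tree labeled by `A`: each `a_j` belongs to
`A_{a_0 … a_{j-1}}`. -/
def IsVertex (A : List ℤ → Set ℤ) (w : List ℤ) : Prop :=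
  ∀ (j : ℕ) (hj : j < w.length), w[j] ∈ A (w.take j)

/-- At each vertex the set of digits is of the form `{0, a}` with `a` odd. -/
def IsDigitSystem (A : List ℤ → Set ℤ) : Prop :=
  ∀ w, IsVertex A w → ∃ a : ℤ, Odd a ∧ A w = {0, a}

/-- The set `Λ` of the finite sums `∑_{k=0}^n 4 ^ k a_k` with `a_k ∈ A_{a_0 … a_{k-1}}`. -/
def finiteSums (A : List ℤ → Set ℤ) : Set ℤ :=
  {x | ∃ (n : ℕ) (a : ℕ → ℤ), (∀ k ≤ n, a k ∈ A (initialWord a k)) ∧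
    x = ∑ k ∈ Finset.range (n + 1), 4 ^ k * a k}

/-- The set `Λ(A)` of the integers that have a modified base 4 expansion with digits in `A`. -/
def modifiedIntegers (A : List ℤ → Set ℤ) : Set ℤ :=
  {x | ∃ a : ℕ → ℤ, (∀ k, a k ∈ A (initialWord a k)) ∧
    ∀ n : ℕ, (∑ k ∈ Finset.range n, a k * 4 ^ k) ≡ x [ZMOD 4 ^ n]}

/-- The sets of digits at the vertices are uniformly bounded. -/
def UniformlyBounded (A : List ℤ → Set ℤ) : Prop :=
  ∃ C : ℤ, ∀ w, IsVertex A w → ∀ a ∈ A w, |a| ≤ C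

end CantorFour

end

noncomputable section

namespace CantorFour

/-! ## Integer labelings of the binary tree -/

/-! Everything is read off from residues modulo `4 ^ n`. A tree whose sibling edges carry integers
of different parity assigns to its `2 ^ n` words of length `n` values that differ pairwise by `4 ^ j
* m` with `m` odd and `j < n` (`ParitySeparated.value_sub`), hence pairwise distinct residues. Both
the digits in `A` and the base 4 labels form such trees. Since `|μ̂₄(t)|²` is the product of the
factors `cos² (π t / (2 * 4 ^ k))`, it vanishes at every `4 ^ j * m` with `m` odd, which gives
orthogonality.

If `Λ ⊆ Λ(L)`, then at each level the residues from `A` inject into those of `L`; there are `2 ^ n`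
of both, so they coincide (`reaches_iff_of_value_mem`). The residues of all levels determine the
labeled tree and its limit integers, whence uniqueness and `Λ(L) = Λ(A)`. For existence, the base 4
digits of the values of `A` are used as labels; continuing a word by zeros produces the expansion of
an integer.

For completeness, the partial products `P_n(t + value)` sum to 1 over the words of each level
(`ParitySeparated.sum_partialIntensity`), by `cos² + sin² = 1` at siblings. With bounded digits,
each word `v` of length `n` has a representative `x ∈ Λ(A)`, congruent to its value, with `|μ̂₄(t +
x)|² ≥ δ P_n` and `δ` independent of `v` (`ParitySeparated.exists_mem_limitIntegers_le`). Any finite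
Bessel sum `σ` can therefore be raised nearly to `σ + δ (1 - σ)`, so the supremum is 1
(`ParitySeparated.exists_lt_sum_intensity`). Thus the closed span contains `e_k` for every integer
`k`, and these span a dense subspace because `μ₄` lives on `[0, 2/3]`, an interval shorter than one
period. -/

theorem initialWord_succ {α : Type*} (s : ℕ → α) (n : ℕ) :
    initialWord s (n + 1) = initialWord s n ++ [s n] := by
  simp [initialWord, List.range_succ]

@[simp] theorem initialWord_zero {α : Type*} (s : ℕ → α) : initialWord s 0 = [] := by
  simp [initialWord]

@[simp] theorem length_initialWord {α : Type*} (s : ℕ → α) (n : ℕ) :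
    (initialWord s n).length = n := by
  simp [initialWord]

/-- The path that follows the word `v` and then always turns to `false`. -/
def pathOf (v : List Bool) (k : ℕ) : Bool := v.getD k false

theorem initialWord_pathOf (v : List Bool) : initialWord (pathOf v) v.length = v := by
  refine List.ext_getElem (by simp) fun i h₁ h₂ => ?_
  simp [initialWord, pathOf, h₂]

/-- The two edges that start from a vertex have labels of different parity. -/
def ParitySeparated (l : List Bool → Bool → ℤ) : Prop :=
  ∀ v, Odd (l v true - l v false)

/-- The integer `∑ 4 ^ k d_k`, where `d_k` are the labels along the word `v`. -/
def value (l : List Bool → Bool → ℤ) (v : List Bool) : ℤ :=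
  ∑ k ∈ Finset.range v.length, 4 ^ k * l (v.take k) (v.getD k false)

@[simp] theorem value_nil (l : List Bool → Bool → ℤ) : value l [] = 0 := by
  simp [value]

theorem value_append (l : List Bool → Bool → ℤ) (v : List Bool) (b : Bool) :
    value l (v ++ [b]) = value l v + 4 ^ v.length * l v b := by
  unfold value
  rw [List.length_append, List.length_singleton, Finset.sum_range_succ]
  congr 1
  · refine Finset.sum_congr rfl fun k hk => ?_
    have hk' := Finset.mem_range.1 hk
    rw [List.take_append_of_le_length hk'.le, List.getD_append _ _ _ _ hk']
  · simp

theorem value_initialWord (l : List Bool → Bool → ℤ) (p : ℕ → Bool) (n : ℕ) :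
    value l (initialWord p n) =
      ∑ k ∈ Finset.range n, 4 ^ k * l (initialWord p k) (p k) := by
  induction n with
  | zero => simp
  | succ n ih => rw [initialWord_succ, value_append, ih, Finset.sum_range_succ, length_initialWord]

theorem exists_eq_append_of_length {v : List Bool} {n : ℕ} (h : v.length = n + 1) :
    ∃ u b, v = u ++ [b] ∧ u.length = n := by
  rcases List.eq_nil_or_concat v with rfl | ⟨u, b, rfl⟩
  · simp at h
  · exact ⟨u, b, by simp, by simpa using h⟩

theorem ParitySeparated.odd_sub {l : List Bool → Bool → ℤ} (hl : ParitySeparated l)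
    (v : List Bool) {a b : Bool} (hab : a ≠ b) : Odd (l v a - l v b) := by
  have := hl v
  cases a <;> cases b
  · exact absurd rfl hab
  · rw [← neg_sub]; exact this.neg
  · exact this
  · exact absurd rfl hab

theorem odd_add_four_pow_mul {m : ℤ} (hm : Odd m) {k : ℕ} (hk : k ≠ 0) (q : ℤ) :
    Odd (m + 4 ^ k * q) := by
  refine hm.add_even (Even.mul_right ?_ q)
  exact (by decide : Even (4 : ℤ)).pow_of_ne_zero hk

/-- The values of two different words of the same length differ by an odd multiple of a
power of four. -/
theorem ParitySeparated.value_sub {l : List Bool → Bool → ℤ} (hl : ParitySeparated l)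
    {n : ℕ} {u v : List Bool} (hu : u.length = n) (hv : v.length = n) (huv : u ≠ v) :
    ∃ j < n, ∃ m, Odd m ∧ value l u - value l v = 4 ^ j * m := by
  induction n generalizing u v with
  | zero => exact absurd (by rw [List.length_eq_zero_iff.1 hu, List.length_eq_zero_iff.1 hv]) huv
  | succ n ih =>
    obtain ⟨u, a, rfl, hu'⟩ := exists_eq_append_of_length hu
    obtain ⟨v, b, rfl, hv'⟩ := exists_eq_append_of_length hv
    rw [value_append, value_append, hu', hv']
    by_cases h : u = v
    · subst h
      have hab : a ≠ b := fun h => huv (by rw [h])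
      exact ⟨n, n.lt_succ_self, _, hl.odd_sub u hab, by ring⟩
    · obtain ⟨j, hj, m, hm, he⟩ := ih hu' hv' h
      -- The new labels contribute a multiple of `4 ^ n` with `n > j`, which leaves the cofactor of
      -- `4 ^ j` odd.
      refine ⟨j, hj.trans n.lt_succ_self, _,
        odd_add_four_pow_mul hm (Nat.sub_ne_zero_of_lt hj) (l u a - l v b), ?_⟩
      have : (4 : ℤ) ^ n = 4 ^ j * 4 ^ (n - j) := by rw [← pow_add, Nat.add_sub_cancel' hj.le]
      rw [mul_add, ← mul_assoc, ← this, ← he]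
      ring

theorem not_four_pow_dvd {j n : ℕ} (hj : j < n) {m : ℤ} (hm : Odd m) :
    ¬ (4 : ℤ) ^ n ∣ 4 ^ j * m := by
  intro h
  have h1 : (4 : ℤ) ^ j * 4 ∣ 4 ^ j * m := (pow_succ (4 : ℤ) j ▸ pow_dvd_pow 4 hj).trans h
  have h2 : (4 : ℤ) ∣ m := (mul_dvd_mul_iff_left (by positivity)).1 h1
  obtain ⟨q, rfl⟩ := hm
  omega

theorem ParitySeparated.eq_of_modEq {l : List Bool → Bool → ℤ} (hl : ParitySeparated l)
    {n : ℕ} {u v : List Bool} (hu : u.length = n) (hv : v.length = n)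
    (h : value l u ≡ value l v [ZMOD 4 ^ n]) : u = v := by
  by_contra huv
  obtain ⟨j, hj, m, hm, he⟩ := hl.value_sub hu hv huv
  exact not_four_pow_dvd hj hm (he ▸ h.symm.dvd)

theorem modEq_four_pow_of_le {a b : ℤ} {m n : ℕ} (hmn : m ≤ n) (h : a ≡ b [ZMOD 4 ^ n]) :
    a ≡ b [ZMOD 4 ^ m] :=
  h.of_dvd (pow_dvd_pow 4 hmn)

theorem value_append_modEq (l : List Bool → Bool → ℤ) (v : List Bool) (b : Bool) :
    value l (v ++ [b]) ≡ value l v [ZMOD 4 ^ v.length] := by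
  rw [value_append]
  exact Int.modEq_iff_dvd.2 ⟨-l v b, by ring⟩

/-- Some word of length `n` has a value congruent to `x` modulo `4 ^ n`. -/
def Reaches (l : List Bool → Bool → ℤ) (n : ℕ) (x : ℤ) : Prop :=
  ∃ v : List Bool, v.length = n ∧ value l v ≡ x [ZMOD 4 ^ n]

/-- The integers that are 4-adic limits of values along an infinite path. -/
def limitIntegers (l : List Bool → Bool → ℤ) : Set ℤ :=
  {x | ∃ p : ℕ → Bool, ∀ n, value l (initialWord p n) ≡ x [ZMOD 4 ^ n]}

/-- No compactness argument is needed: a residue determines its word, so the words found at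
successive levels automatically extend one another. -/
theorem ParitySeparated.mem_limitIntegers_iff {l : List Bool → Bool → ℤ} (hl : ParitySeparated l)
    {x : ℤ} : x ∈ limitIntegers l ↔ ∀ n, Reaches l n x := by
  refine ⟨fun ⟨p, hp⟩ n => ⟨_, length_initialWord p n, hp n⟩, fun h => ?_⟩
  choose v hv hx using h
  have key : ∀ n, ∃ b, v (n + 1) = v n ++ [b] := by
    intro n
    obtain ⟨u, b, he, hu⟩ := exists_eq_append_of_length (hv (n + 1))
    refine ⟨b, ?_⟩
    have : u = v n := by
      refine hl.eq_of_modEq hu (hv n) ?_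
      have h1 := hu ▸ (value_append_modEq l u b).symm
      rw [← he] at h1
      exact (h1.trans (modEq_four_pow_of_le n.le_succ (hx (n + 1)))).trans (hx n).symm
    rw [he, this]
  choose p hp using key
  have : ∀ n, initialWord p n = v n := by
    intro n
    induction n with
    | zero => rw [initialWord_zero, List.length_eq_zero_iff.1 (hv 0)]
    | succ n ih => rw [initialWord_succ, ih, hp]
  exact ⟨p, fun n => by rw [this]; exact hx n⟩

theorem Reaches.congr {l : List Bool → Bool → ℤ} {n : ℕ} {x y : ℤ} (h : Reaches l n x)
    (hxy : x ≡ y [ZMOD 4 ^ n]) : Reaches l n y :=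
  let ⟨v, hv, hx⟩ := h
  ⟨v, hv, hx.trans hxy⟩

theorem reaches_value (l : List Bool → Bool → ℤ) (v : List Bool) :
    Reaches l v.length (value l v) := ⟨v, rfl, rfl⟩

theorem value_modEq_take (l : List Bool → Bool → ℤ) (v : List Bool) (n : ℕ) :
    value l v ≡ value l (v.take n) [ZMOD 4 ^ n] := by
  induction v using List.reverseRecOn with
  | nil => simp
  | append_singleton v b ih =>
    rcases le_or_gt n v.length with h | h
    · rw [List.take_append_of_le_length h]
      exact (modEq_four_pow_of_le h (value_append_modEq l v b)).trans ih
    · rw [List.take_of_length_le (by simpa using h)]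

theorem Reaches.of_le {l : List Bool → Bool → ℤ} {m n : ℕ} {x : ℤ} (h : Reaches l n x)
    (hmn : m ≤ n) : Reaches l m x := by
  obtain ⟨v, rfl, hx⟩ := h
  exact ⟨v.take m, by simp [hmn], (value_modEq_take l v m).symm.trans (modEq_four_pow_of_le hmn hx)⟩

/-- From every vertex, an edge can be chosen so that the value has the right parity. -/
theorem ParitySeparated.exists_append_modEq {l : List Bool → Bool → ℤ} (hl : ParitySeparated l)
    {v : List Bool} {x : ℤ} (h : value l v ≡ x [ZMOD 4 ^ v.length]) :
    ∃ b q, x = value l (v ++ [b]) + 4 ^ v.length * (2 * q) := by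
  obtain ⟨c, hc⟩ := h.dvd
  obtain ⟨b, q, hq⟩ : ∃ b q, c = l v b + 2 * q := by
    obtain ⟨m, hm⟩ := hl v
    rcases Int.even_or_odd' (c - l v false) with ⟨q, hq | hq⟩
    · exact ⟨false, q, by omega⟩
    · exact ⟨true, q - m, by omega⟩
  refine ⟨b, q, ?_⟩
  rw [value_append, eq_add_of_sub_eq hc, hq]
  ring

/-! ## The words of a given length -/

/-- The finite set of binary words of length `n`. -/
def words : ℕ → Finset (List Bool)
  | 0 => {[]}
  | n + 1 => (words n ×ˢ Finset.univ).image fun q : List Bool × Bool => q.1 ++ [q.2]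

theorem mem_words {n : ℕ} {v : List Bool} : v ∈ words n ↔ v.length = n := by
  induction n generalizing v with
  | zero => simp [words]
  | succ n ih =>
    simp only [words, Finset.mem_image, Finset.mem_product, Finset.mem_univ, and_true,
      Prod.exists]
    constructor
    · rintro ⟨u, b, hu, rfl⟩
      simp [ih.1 hu]
    · intro h
      obtain ⟨u, b, rfl, hu⟩ := exists_eq_append_of_length h
      exact ⟨u, b, ih.2 hu, rfl⟩

theorem sum_words_succ {β : Type*} [AddCommMonoid β] (f : List Bool → β) (n : ℕ) :
    ∑ v ∈ words (n + 1), f v = ∑ v ∈ words n, (f (v ++ [true]) + f (v ++ [false])) := by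
  rw [words, Finset.sum_image, Finset.sum_product]
  · simp
  · rintro ⟨u, a⟩ - ⟨v, b⟩ - h
    simpa using h

/-- If all values of the words of `l` are limits for `l'`, the two labelings have the same
residues at every level. -/
theorem reaches_iff_of_value_mem {l l' : List Bool → Bool → ℤ} (hl : ParitySeparated l)
    (h : ∀ v, value l v ∈ limitIntegers l') (n : ℕ) (x : ℤ) :
    Reaches l' n x ↔ Reaches l n x := by
  have h1 : ∀ v, ∃ u : List Bool, v.length = n → u.length = n ∧
      value l' u ≡ value l v [ZMOD 4 ^ n] := by
    intro v
    obtain ⟨p, hp⟩ := h v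
    exact ⟨initialWord p n, fun _ => ⟨length_initialWord p n, hp n⟩⟩
  choose f hf using h1
  have hinj : Set.InjOn f (words n) := by
    intro u hu v hv huv
    have hu' := mem_words.1 hu
    have hv' := mem_words.1 hv
    refine hl.eq_of_modEq hu' hv' ?_
    exact (huv ▸ (hf u hu').2).symm.trans (hf v hv').2
  -- An injective self-map of the finite set of words is onto.
  have himg : (words n).image f = words n := by
    refine Finset.eq_of_subset_of_card_le ?_ (Finset.card_image_of_injOn hinj).ge
    intro u hu
    obtain ⟨v, hv, rfl⟩ := Finset.mem_image.1 hu
    exact mem_words.2 (hf v (mem_words.1 hv)).1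
  constructor
  · rintro ⟨u, hu, hx⟩
    obtain ⟨v, hv, rfl⟩ := Finset.mem_image.1 (himg ▸ mem_words.2 hu)
    have hv' := mem_words.1 hv
    exact ⟨v, hv', (hf v hv').2.symm.trans hx⟩
  · rintro ⟨v, hv, hx⟩
    exact ⟨f v, (hf v hv).1, (hf v hv).2.trans hx⟩

/-! ## Labelings by base 4 digits -/

/-- The labels of `L` as integers. -/
def Labeling.toInt (L : Labeling) (v : List Bool) (b : Bool) : ℤ := (L v b).val

theorem IsSpectralLabeling.paritySeparated {L : Labeling} (hL : IsSpectralLabeling L) :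
    ParitySeparated L.toInt := by
  intro v
  have := hL.1 v
  rw [Int.odd_iff]
  unfold Labeling.toInt
  omega

theorem Labeling.toInt_nonneg (L : Labeling) (v : List Bool) (b : Bool) : 0 ≤ L.toInt v b := by
  unfold Labeling.toInt
  omega

theorem Labeling.toInt_lt (L : Labeling) (v : List Bool) (b : Bool) : L.toInt v b < 4 := by
  have := (L v b).isLt
  unfold Labeling.toInt
  omega

/-- For base 4 labels the value is thus the least residue modulo `4 ^ n`, and congruences become
equalities. -/
theorem Labeling.value_bounds (L : Labeling) {n : ℕ} {v : List Bool} (hv : v.length = n) :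
    0 ≤ value L.toInt v ∧ value L.toInt v < 4 ^ n := by
  induction n generalizing v with
  | zero => simp [List.length_eq_zero_iff.1 hv]
  | succ n ih =>
    obtain ⟨u, b, rfl, hu⟩ := exists_eq_append_of_length hv
    obtain ⟨h0, h1⟩ := ih hu
    have h2 := L.toInt_nonneg u b
    have h3 : L.toInt u b ≤ 3 := Int.lt_add_one_iff.1 (L.toInt_lt u b)
    have h4 : (0 : ℤ) < 4 ^ n := by positivity
    rw [value_append, hu, pow_succ]
    constructor
    · positivity
    · nlinarith

theorem Labeling.eq_emod_of_modEq (L : Labeling) {n : ℕ} {v : List Bool} (hv : v.length = n)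
    {x : ℤ} (h : value L.toInt v ≡ x [ZMOD 4 ^ n]) : value L.toInt v = x % 4 ^ n := by
  obtain ⟨h0, h1⟩ := L.value_bounds hv
  rw [← h.eq, Int.emod_eq_of_lt h0 h1]

theorem base4Quot_eq (k : ℤ) (n : ℕ) : base4Quot k n = k / 4 ^ n := by
  induction n with
  | zero => simp [base4Quot]
  | succ n ih => rw [base4Quot, ih, pow_succ, Int.ediv_ediv_of_nonneg (by positivity)]

theorem base4Digit_eq (k : ℤ) (n : ℕ) : base4Digit k n = k / 4 ^ n % 4 := by
  rw [base4Digit, base4Quot_eq]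

theorem emod_four_pow_succ (k : ℤ) (n : ℕ) :
    k % 4 ^ (n + 1) = k % 4 ^ n + 4 ^ n * base4Digit k n := by
  rw [base4Digit_eq]
  have h1 := Int.emod_add_mul_ediv k (4 ^ n)
  have h2 := Int.emod_add_mul_ediv k (4 ^ (n + 1))
  have h3 := Int.emod_add_mul_ediv (k / 4 ^ n) 4
  rw [Int.ediv_ediv_of_nonneg (by positivity), ← pow_succ] at h3
  have h4 : (4 : ℤ) ^ n * (k / 4 ^ n % 4 + 4 * (k / 4 ^ (n + 1))) = 4 ^ n * (k / 4 ^ n) := by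
    rw [h3]
  rw [pow_succ] at *
  linarith

/-- Once `4 ^ n > |k|`, the quotient is `0` or `-1` according to the sign of `k`, and `-1 % 4 = 3`.
-/
theorem base4Digit_eventually (k : ℤ) :
    (∃ N, ∀ n, N ≤ n → base4Digit k n = 0) ∨ ∃ N, ∀ n, N ≤ n → base4Digit k n = 3 := by
  have hk : ∀ n, k.natAbs ≤ n → |k| < 4 ^ n := by
    intro n hn
    have h1 : k.natAbs < 4 ^ n :=
      (Nat.lt_pow_self (by norm_num : 1 < 4)).trans_le (Nat.pow_le_pow_right (by norm_num) hn)
    rw [Int.abs_eq_natAbs]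
    exact_mod_cast h1
  rcases le_or_gt 0 k with h | h
  · refine Or.inl ⟨k.natAbs, fun n hn => ?_⟩
    rw [base4Digit_eq, Int.ediv_eq_zero_of_lt h ((le_abs_self k).trans_lt (hk n hn)),
      Int.zero_emod]
  · refine Or.inr ⟨k.natAbs, fun n hn => ?_⟩
    have h1 := hk n hn
    rw [abs_of_neg h] at h1
    have h2 : k / 4 ^ n = -1 := by
      rw [Int.ediv_eq_iff_of_pos (by positivity)]
      constructor <;> linarith
    rw [base4Digit_eq, h2]
    rfl

/-- The condition on the tail costs nothing, since the expansion of every integer satisfies it. -/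
theorem Labeling.integers_eq (L : Labeling) : L.integers = limitIntegers L.toInt := by
  ext k
  constructor
  · rintro ⟨p, -, hp⟩
    refine ⟨p, fun n => ?_⟩
    have : value L.toInt (initialWord p n) = k % 4 ^ n := by
      induction n with
      | zero => simp
      | succ n ih =>
        rw [initialWord_succ, value_append, ih, emod_four_pow_succ, hp, length_initialWord]
        simp [Labeling.read, Labeling.toInt]
    rw [this]
    exact Int.mod_modEq _ _
  · rintro ⟨p, hp⟩
    have hd : ∀ n, base4Digit k n = ((L.read [] p n).val : ℤ) := by
      intro n
      have h1 := L.eq_emod_of_modEq (length_initialWord p n) (hp n)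
      have h2 := L.eq_emod_of_modEq (length_initialWord p (n + 1)) (hp (n + 1))
      rw [initialWord_succ, value_append, emod_four_pow_succ, h1, length_initialWord] at h2
      have h3 := mul_left_cancel₀ (by positivity) (add_left_cancel h2)
      rw [← h3]
      simp [Labeling.read, Labeling.toInt]
    refine ⟨p, ?_, hd⟩
    refine (base4Digit_eventually k).imp ?_ ?_
    all_goals
      rintro ⟨N, hN⟩
      refine ⟨N, fun n hn => Fin.ext ?_⟩
      have := hN n hn
      rw [hd] at this
      exact Int.natCast_inj.1 this

/-- The automorphism matches words of equal length and equal value. It respects prefixes because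
reduction modulo a smaller power of four does. -/
theorem Labeling.sameTree_of_reaches {L L' : Labeling} (hL : ParitySeparated L.toInt)
    (hL' : ParitySeparated L'.toInt)
    (h : ∀ n x, Reaches L.toInt n x ↔ Reaches L'.toInt n x) : L.SameTree L' := by
  have hex : ∀ {L L' : Labeling}, (∀ n x, Reaches L.toInt n x → Reaches L'.toInt n x) →
      ∀ v : List Bool, ∃ u : List Bool, u.length = v.length ∧
        value L'.toInt u = value L.toInt v := by
    intro L L' h v
    obtain ⟨u, hu, he⟩ := h _ _ (reaches_value L.toInt v)
    obtain ⟨h0, h1⟩ := L.value_bounds (v := v) rfl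
    exact ⟨u, hu, (L'.eq_emod_of_modEq hu he).trans (Int.emod_eq_of_lt h0 h1)⟩
  choose f hf hf' using hex fun n x => (h n x).1
  choose g hg hg' using hex fun n x => (h n x).2
  let φ : List Bool ≃ List Bool :=
    { toFun := f
      invFun := g
      left_inv := fun v => hL.eq_of_modEq (n := v.length) (by rw [hg, hf]) rfl
        (by rw [hg', hf'])
      right_inv := fun v => hL'.eq_of_modEq (n := v.length) (by rw [hf, hg]) rfl
        (by rw [hf', hg']) }
  refine ⟨φ, List.length_eq_zero_iff.1 (hf []), fun v b => ?_⟩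
  change ∃ b', f (v ++ [b]) = f v ++ [b'] ∧ L' (f v) b' = L v b
  obtain ⟨u, b', he, hu⟩ := exists_eq_append_of_length (v := f (v ++ [b])) (n := v.length)
    (by rw [hf]; simp)
  have hval := hf' (v ++ [b])
  rw [he, value_append, value_append, hu] at hval
  have hmod : value L'.toInt u ≡ value L.toInt v [ZMOD 4 ^ v.length] :=
    Int.modEq_iff_dvd.2 ⟨L'.toInt u b' - L.toInt v b, by linarith⟩
  have huv : u = f v := hL'.eq_of_modEq hu (hf v) (by rw [hf']; exact hmod)
  refine ⟨b', by rw [he, huv], ?_⟩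
  rw [huv, hf'] at hval
  have h3 := mul_left_cancel₀ (by positivity) (add_left_cancel hval)
  unfold Labeling.toInt at h3
  exact Fin.ext (by exact_mod_cast h3)

/-! ## The base 4 labeling of an integer labeling -/

/-- The labeling by the base 4 digits of the values of `l`. -/
def digitLabeling (l : List Bool → Bool → ℤ) : Labeling := fun v b =>
  ⟨((value l v / 4 ^ v.length + l v b) % 4).toNat, by omega⟩

theorem toInt_digitLabeling (l : List Bool → Bool → ℤ) (v : List Bool) (b : Bool) :
    (digitLabeling l).toInt v b = (value l v / 4 ^ v.length + l v b) % 4 := by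
  unfold Labeling.toInt digitLabeling
  simp only
  omega

theorem toInt_digitLabeling_eq_base4Digit (l : List Bool → Bool → ℤ) (v : List Bool) (b : Bool) :
    (digitLabeling l).toInt v b = base4Digit (value l (v ++ [b])) v.length := by
  rw [toInt_digitLabeling, base4Digit_eq, value_append,
    Int.add_mul_ediv_left _ _ (by positivity)]

/-- The quotient `value l v / 4 ^ v.length` in the label is the carry from the earlier digits, so
each label is the next base 4 digit of the value. -/
theorem value_digitLabeling (l : List Bool → Bool → ℤ) {n : ℕ} {v : List Bool}
    (hv : v.length = n) : value (digitLabeling l).toInt v = value l v % 4 ^ n := by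
  induction n generalizing v with
  | zero => simp [List.length_eq_zero_iff.1 hv]
  | succ n ih =>
    obtain ⟨u, b, rfl, hu⟩ := exists_eq_append_of_length hv
    have hmod := value_append_modEq l u b
    rw [hu] at hmod
    rw [emod_four_pow_succ, value_append, toInt_digitLabeling_eq_base4Digit, ih hu, hu, hmod.eq]

theorem reaches_digitLabeling (l : List Bool → Bool → ℤ) (n : ℕ) (x : ℤ) :
    Reaches (digitLabeling l).toInt n x ↔ Reaches l n x := by
  refine exists_congr fun v => and_congr_right fun hv => ?_
  rw [value_digitLabeling l hv]
  exact ⟨(Int.mod_modEq _ _).symm.trans, (Int.mod_modEq _ _).trans⟩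

theorem value_append_replicate {l : List Bool → Bool → ℤ} (h0 : ∀ v, l v false = 0)
    (v : List Bool) (n : ℕ) : value l (v ++ List.replicate n false) = value l v := by
  induction n with
  | zero => simp
  | succ n ih =>
    rw [List.replicate_succ', ← List.append_assoc, value_append, h0, ih, mul_zero, add_zero]

theorem ParitySeparated.value_mem_limitIntegers {l : List Bool → Bool → ℤ}
    (hl : ParitySeparated l) (h0 : ∀ v, l v false = 0) (v : List Bool) :
    value l v ∈ limitIntegers l := by
  rw [hl.mem_limitIntegers_iff]
  intro n
  rcases le_total n v.length with h | h
  · exact (reaches_value l v).of_le h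
  · refine ⟨v ++ List.replicate (n - v.length) false, by simp; omega, ?_⟩
    rw [value_append_replicate h0]

/-- Siblings share the same carry, and reduction modulo 4 preserves parity. The path that always
turns to `false` reads the remaining digits of the integer `value l v`. -/
theorem isSpectralLabeling_digitLabeling {l : List Bool → Bool → ℤ} (hl : ParitySeparated l)
    (h0 : ∀ v, l v false = 0) : IsSpectralLabeling (digitLabeling l) := by
  constructor
  · intro v
    have h1 := toInt_digitLabeling l v false
    have h2 := toInt_digitLabeling l v true
    obtain ⟨m, hm⟩ := hl v
    unfold Labeling.toInt at h1 h2
    omega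
  · intro v
    refine ⟨fun _ => false, ?_⟩
    have hw : ∀ n, initialWord (fun _ : ℕ => false) n = List.replicate n false := by
      intro n
      simp [initialWord]
    have hd : ∀ n, (((digitLabeling l).read v (fun _ => false) n).val : ℤ) =
        base4Digit (value l v) (v.length + n) := by
      intro n
      have h1 := toInt_digitLabeling_eq_base4Digit l (v ++ List.replicate n false) false
      rw [List.append_assoc, ← List.replicate_succ', value_append_replicate h0] at h1
      rw [Labeling.read, hw]
      simpa [Labeling.toInt] using h1
    refine (base4Digit_eventually (value l v)).imp ?_ ?_
    all_goals
      rintro ⟨N, hN⟩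
      refine ⟨N, fun n hn => Fin.ext ?_⟩
      have := hd n
      rw [hN _ (by omega)] at this
      exact Int.natCast_inj.1 this

/-! ## Systems of digits as integer labelings -/

/-- The odd element of `A w`. -/
def oddDigit (A : List ℤ → Set ℤ) (w : List ℤ) : ℤ :=
  -- The odd default keeps the labeling parity separated at words that are not vertices.
  open Classical in if h : ∃ a : ℤ, Odd a ∧ A w = {0, a} then h.choose else 1

theorem odd_oddDigit (A : List ℤ → Set ℤ) (w : List ℤ) : Odd (oddDigit A w) := by
  unfold oddDigit
  split_ifs with h
  · exact h.choose_spec.1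
  · exact odd_one

/-- The word of digits in `A` that a binary word selects. -/
def digitWord (A : List ℤ → Set ℤ) (v : List Bool) : List ℤ :=
  v.foldl (fun w b => w ++ [if b then oddDigit A w else 0]) []

/-- The digit of `A` that is selected by the edge from `v` to `v ++ [b]`. -/
def digit (A : List ℤ → Set ℤ) (v : List Bool) (b : Bool) : ℤ :=
  if b then oddDigit A (digitWord A v) else 0

theorem digitWord_append (A : List ℤ → Set ℤ) (v : List Bool) (b : Bool) :
    digitWord A (v ++ [b]) = digitWord A v ++ [digit A v b] := by
  simp [digitWord, digit, List.foldl_append]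

@[simp] theorem digit_false (A : List ℤ → Set ℤ) (v : List Bool) : digit A v false = 0 := by
  simp [digit]

theorem paritySeparated_digit (A : List ℤ → Set ℤ) : ParitySeparated (digit A) := by
  intro v
  simpa [digit] using odd_oddDigit A _

theorem isVertex_append {A : List ℤ → Set ℤ} {w : List ℤ} (hw : IsVertex A w) {a : ℤ}
    (ha : a ∈ A w) : IsVertex A (w ++ [a]) := by
  intro j hj
  rcases Nat.lt_or_ge j w.length with h | h
  · rw [List.getElem_append_left h, List.take_append_of_le_length h.le]
    exact hw j h
  · have : j = w.length := by simp at hj; omega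
    subst this
    simpa using ha

variable {A : List ℤ → Set ℤ}

theorem IsDigitSystem.eq_oddDigit (hA : IsDigitSystem A) {w : List ℤ} (hw : IsVertex A w) :
    A w = {0, oddDigit A w} := by
  have h := hA w hw
  rw [oddDigit, dif_pos h]
  exact h.choose_spec.2

theorem IsDigitSystem.isVertex_digitWord (hA : IsDigitSystem A) (v : List Bool) :
    IsVertex A (digitWord A v) ∧ ∀ b, digit A v b ∈ A (digitWord A v) := by
  have key : ∀ v, IsVertex A (digitWord A v) → ∀ b, digit A v b ∈ A (digitWord A v) := by
    intro v hv b
    rw [hA.eq_oddDigit hv]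
    cases b <;> simp [digit]
  suffices h : IsVertex A (digitWord A v) from ⟨h, key v h⟩
  induction v using List.reverseRecOn with
  | nil => intro j hj; simp [digitWord] at hj
  | append_singleton v b ih =>
    rw [digitWord_append]
    exact isVertex_append ih (key v ih b)

theorem initialWord_digit (A : List ℤ → Set ℤ) (p : ℕ → Bool) (n : ℕ) :
    initialWord (fun k => digit A (initialWord p k) (p k)) n = digitWord A (initialWord p n) := by
  induction n with
  | zero => simp [digitWord]
  | succ n ih => rw [initialWord_succ, initialWord_succ, digitWord_append, ih]

/-- Every sequence of digits in `A` is selected by a binary path. -/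
theorem IsDigitSystem.exists_path (hA : IsDigitSystem A) {a : ℕ → ℤ} {n : ℕ}
    (ha : ∀ k < n, a k ∈ A (initialWord a k)) :
    ∀ k < n, digit A (initialWord (fun k => decide (a k ≠ 0)) k) (decide (a k ≠ 0)) = a k := by
  -- The odd digit is nonzero, so a digit determines its edge.
  set p : ℕ → Bool := fun k => decide (a k ≠ 0) with hp
  have step : ∀ k < n, digitWord A (initialWord p k) = initialWord a k →
      digit A (initialWord p k) (p k) = a k := by
    intro k hk h
    have h1 := ha k hk
    rw [← h, hA.eq_oddDigit (hA.isVertex_digitWord _).1] at h1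
    by_cases h0 : a k = 0
    · simp [hp, h0]
    · have h2 : a k = oddDigit A (digitWord A (initialWord p k)) := by simpa [h0] using h1
      rw [digit, ← h2]
      simp [hp, h0]
  have main : ∀ k ≤ n, digitWord A (initialWord p k) = initialWord a k := by
    intro k
    induction k with
    | zero => simp [digitWord]
    | succ k ih =>
      intro hk
      rw [initialWord_succ, initialWord_succ, digitWord_append, ih (by omega),
        step k hk (ih (by omega))]
  exact fun k hk => step k hk (main k hk.le)

theorem IsDigitSystem.finiteSums_eq (hA : IsDigitSystem A) :
    finiteSums A = Set.range (value (digit A)) := by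
  ext x
  constructor
  · rintro ⟨n, a, ha, rfl⟩
    refine ⟨initialWord (fun k => decide (a k ≠ 0)) (n + 1), ?_⟩
    rw [value_initialWord]
    refine Finset.sum_congr rfl fun k hk => ?_
    rw [hA.exists_path (fun k hk => ha k (Nat.lt_succ_iff.1 hk)) k (Finset.mem_range.1 hk)]
  · rintro ⟨v, rfl⟩
    -- The sum has `v.length + 1` terms; the extra digit is `0`, which also covers the empty word.
    refine ⟨v.length, fun k => digit A (initialWord (pathOf v) k) (pathOf v k), fun k _ => ?_, ?_⟩
    · rw [initialWord_digit]
      exact (hA.isVertex_digitWord _).2 _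
    · rw [← value_initialWord, initialWord_succ, initialWord_pathOf, value_append]
      simp [pathOf]

theorem IsDigitSystem.modifiedIntegers_eq (hA : IsDigitSystem A) :
    modifiedIntegers A = limitIntegers (digit A) := by
  ext x
  constructor
  · rintro ⟨a, ha, h⟩
    refine ⟨fun k => decide (a k ≠ 0), fun n => ?_⟩
    convert h n using 1
    rw [value_initialWord]
    refine Finset.sum_congr rfl fun k _ => ?_
    rw [hA.exists_path (n := k + 1) (fun k _ => ha k) k k.lt_succ_self, mul_comm]
  · rintro ⟨p, hp⟩
    refine ⟨fun k => digit A (initialWord p k) (p k), fun k => ?_, fun n => ?_⟩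
    · rw [initialWord_digit]
      exact (hA.isVertex_digitWord _).2 _
    · convert hp n using 1
      rw [value_initialWord]
      exact Finset.sum_congr rfl fun k _ => mul_comm _ _

theorem IsDigitSystem.exists_labeling (hA : IsDigitSystem A) :
    ∃ L : Labeling, IsSpectralLabeling L ∧ finiteSums A ⊆ L.integers := by
  have hs := paritySeparated_digit A
  have hL := isSpectralLabeling_digitLabeling hs (digit_false A)
  refine ⟨digitLabeling (digit A), hL, ?_⟩
  rw [hA.finiteSums_eq, Labeling.integers_eq]
  rintro _ ⟨v, rfl⟩
  rw [hL.paritySeparated.mem_limitIntegers_iff]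
  intro n
  rw [reaches_digitLabeling]
  exact hs.mem_limitIntegers_iff.1 (hs.value_mem_limitIntegers (digit_false A) v) n

theorem IsDigitSystem.reaches_iff (hA : IsDigitSystem A) {L : Labeling}
    (h : finiteSums A ⊆ L.integers) (n : ℕ) (x : ℤ) :
    Reaches L.toInt n x ↔ Reaches (digit A) n x := by
  refine reaches_iff_of_value_mem (paritySeparated_digit A) (fun v => ?_) n x
  rw [← Labeling.integers_eq]
  exact h (hA.finiteSums_eq ▸ ⟨v, rfl⟩)

theorem IsDigitSystem.sameTree (hA : IsDigitSystem A) {L L' : Labeling}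
    (hL : IsSpectralLabeling L) (h : finiteSums A ⊆ L.integers)
    (hL' : IsSpectralLabeling L') (h' : finiteSums A ⊆ L'.integers) : L.SameTree L' :=
  Labeling.sameTree_of_reaches hL.paritySeparated hL'.paritySeparated fun n x =>
    (hA.reaches_iff h n x).trans (hA.reaches_iff h' n x).symm

theorem IsDigitSystem.integers_eq (hA : IsDigitSystem A) {L : Labeling}
    (hL : IsSpectralLabeling L) (h : finiteSums A ⊆ L.integers) :
    L.integers = limitIntegers (digit A) := by
  ext x
  rw [Labeling.integers_eq, hL.paritySeparated.mem_limitIntegers_iff,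
    (paritySeparated_digit A).mem_limitIntegers_iff]
  exact forall_congr' fun n => hA.reaches_iff h n x

/-- Different integers are separated modulo some `4 ^ n`, so their paths differ by level `n`.
Passing from values to limits adds multiples of `4 ^ n` with `n > j`, which keep the cofactor odd.
-/
theorem ParitySeparated.limitIntegers_sub {l : List Bool → Bool → ℤ} (hl : ParitySeparated l)
    {x y : ℤ} (hx : x ∈ limitIntegers l) (hy : y ∈ limitIntegers l) (hxy : x ≠ y) :
    ∃ (j : ℕ) (m : ℤ), Odd m ∧ x - y = 4 ^ j * m := by
  obtain ⟨p, hp⟩ := hx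
  obtain ⟨q, hq⟩ := hy
  obtain ⟨n, hn⟩ : ∃ n, ¬ x ≡ y [ZMOD 4 ^ n] := by
    by_contra! h
    refine hxy (sub_eq_zero.1 (Int.eq_zero_of_abs_lt_dvd (m := 4 ^ (x - y).natAbs) ?_ ?_))
    · exact (h _).symm.dvd
    · rw [Int.abs_eq_natAbs]
      exact_mod_cast Nat.lt_pow_self (by norm_num : 1 < 4)
  have hne : initialWord p n ≠ initialWord q n := fun h =>
    hn ((hp n).symm.trans (h ▸ hq n))
  obtain ⟨j, hj, m, hm, he⟩ :=
    hl.value_sub (length_initialWord p n) (length_initialWord q n) hne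
  obtain ⟨c, hc⟩ := (hp n).dvd
  obtain ⟨d, hd⟩ := (hq n).dvd
  refine ⟨j, _, odd_add_four_pow_mul hm (Nat.sub_ne_zero_of_lt hj) (c - d), ?_⟩
  have : (4 : ℤ) ^ n = 4 ^ j * 4 ^ (n - j) := by rw [← pow_add, Nat.add_sub_cancel' hj.le]
  rw [mul_add, ← mul_assoc, ← this, ← he]
  linarith

/-- The only use of uniform boundedness: it confines the rescaled points `(t + value) / 4 ^ n` to a
compact interval. -/
theorem UniformlyBounded.abs_value_le (hA : IsDigitSystem A) (hb : UniformlyBounded A) :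
    ∃ C : ℤ, ∀ v, |value (digit A) v| ≤ C * 4 ^ v.length := by
  obtain ⟨C, hC⟩ := hb
  refine ⟨C, fun v => ?_⟩
  have hdig : ∀ v b, |digit A v b| ≤ C := fun v b =>
    hC _ (hA.isVertex_digitWord v).1 _ ((hA.isVertex_digitWord v).2 b)
  have hC0 : 0 ≤ C := (abs_nonneg _).trans (hdig [] true)
  induction v using List.reverseRecOn with
  | nil => simpa using hC0
  | append_singleton v b ih =>
    rw [value_append, List.length_append, List.length_singleton, pow_succ]
    have h4 : (0 : ℤ) < 4 ^ v.length := by positivity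
    refine (abs_add_le _ _).trans ?_
    rw [abs_mul, abs_of_pos h4]
    nlinarith [hdig v b, mul_nonneg hC0 h4.le]

/-! ## The Fourier transform of `μ₄` -/

/-- The binary sequence with first term `c` followed by `b`. -/
def consSeq (q : Bool × (ℕ → Bool)) (n : ℕ) : Bool := Nat.casesOn n q.1 q.2

theorem measurable_consSeq : Measurable consSeq := by
  rw [measurable_pi_iff]
  rintro (_ | n)
  · exact measurable_fst
  · exact (measurable_pi_apply n).comp measurable_snd

theorem map_consSeq :
    (coin.prod (Measure.infinitePi fun _ : ℕ => coin)).map consSeq =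
      Measure.infinitePi fun _ : ℕ => coin := by
  refine Measure.eq_infinitePi _ fun s t ht => ?_
  classical
  -- The box is padded with trivial sides to an initial segment, so that coordinate 0 splits off.
  obtain ⟨N, hN⟩ : ∃ N, s ⊆ Finset.range (N + 1) := by
    refine ⟨s.sup id, fun i hi => Finset.mem_range.2 (Nat.lt_succ_of_le ?_)⟩
    exact Finset.le_sup (f := id) hi
  let t' : ℕ → Set Bool := fun i => if i ∈ s then t i else Set.univ
  have ht' : ∀ i, MeasurableSet (t' i) := fun i => MeasurableSet.of_discrete
  have hpi : (s : Set ℕ).pi t = ((Finset.range (N + 1) : Finset ℕ) : Set ℕ).pi t' := by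
    ext b
    simp only [Set.mem_pi, Finset.mem_coe, t']
    constructor
    · intro h i _
      split_ifs with hi
      · exact h i hi
      · trivial
    · intro h i hi
      simpa [hi] using h i (hN hi)
  have hprod : ∏ i ∈ s, coin (t i) = ∏ i ∈ Finset.range (N + 1), coin (t' i) := by
    rw [← Finset.prod_subset hN]
    · exact Finset.prod_congr rfl fun i hi => by simp [t', hi]
    · intro i _ hi
      rw [show t' i = Set.univ from if_neg hi, measure_univ]
  have hpre : consSeq ⁻¹' (((Finset.range (N + 1) : Finset ℕ) : Set ℕ).pi t') =
      t' 0 ×ˢ ((Finset.range N : Finset ℕ) : Set ℕ).pi fun i => t' (i + 1) := by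
    ext ⟨c, b⟩
    simp only [Set.mem_preimage, Set.mem_pi, Finset.mem_coe, Finset.mem_range, Set.mem_prod]
    constructor
    · intro h
      exact ⟨h 0 N.succ_pos, fun i hi => h (i + 1) (Nat.succ_lt_succ hi)⟩
    · rintro ⟨h0, h⟩ (_ | i) hi
      · exact h0
      · exact h i (Nat.lt_of_succ_lt_succ hi)
  rw [hpi, hprod, Measure.map_apply measurable_consSeq
    (MeasurableSet.pi (Finset.countable_toSet _) fun i _ => ht' i), hpre, Measure.prod_prod,
    Measure.infinitePi_pi _ fun i _ => ht' (i + 1), Finset.prod_range_succ', mul_comm]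

theorem cantorPoint_consSeq (c : Bool) (b : ℕ → Bool) :
    cantorPoint (consSeq (c, b)) = ((if c then 2 else 0) + cantorPoint b) / 4 := by
  unfold cantorPoint
  rw [(summable_cantorPoint _).tsum_eq_zero_add, add_div, ← tsum_div_const]
  congr 1
  · cases c <;> simp [consSeq]
  · refine tsum_congr fun k => ?_
    rw [pow_succ, div_mul_eq_div_div]
    rfl

theorem cantorPoint_mem_Icc (b : ℕ → Bool) : cantorPoint b ∈ Set.Icc (0 : ℝ) (2 / 3) := by
  have hg : HasSum (fun k : ℕ => (2 / 4 : ℝ) * (1 / 4) ^ k) (2 / 3) := by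
    have := (hasSum_geometric_of_lt_one (by norm_num) (by norm_num : (1 / 4 : ℝ) < 1)).mul_left
      (2 / 4 : ℝ)
    norm_num at this ⊢
    exact this
  constructor
  · refine tsum_nonneg fun k => ?_
    split_ifs <;> positivity
  · rw [← hg.tsum_eq]
    refine (summable_cantorPoint b).tsum_le_tsum (fun k => ?_) hg.summable
    rw [one_div, inv_pow, pow_succ, ← div_eq_mul_inv, div_div, mul_comm (4 : ℝ)]
    gcongr
    split_ifs <;> norm_num

theorem ae_mem_Icc_mu4 : ∀ᵐ x ∂mu4, x ∈ Set.Icc (0 : ℝ) (2 / 3) := by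
  unfold mu4
  rw [ae_map_iff measurable_cantorPoint.aemeasurable
    (p := fun x => x ∈ Set.Icc (0 : ℝ) (2 / 3)) measurableSet_Icc]
  exact Filter.Eventually.of_forall cantorPoint_mem_Icc

theorem continuous_expFun (t : ℝ) : Continuous (expFun t) := by
  unfold expFun
  fun_prop

theorem integrable_expFun (μ : Measure ℝ) [IsFiniteMeasure μ] (t : ℝ) :
    Integrable (expFun t) μ :=
  (memLp_expFun μ t).integrable (by norm_num)

theorem expFun_add (s t x : ℝ) : expFun (s + t) x = expFun s x * expFun t x := by
  unfold expFun
  rw [← Complex.exp_add]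
  congr 1
  push_cast
  ring

theorem conj_expFun (t x : ℝ) : (starRingEnd ℂ) (expFun t x) = expFun (-t) x := by
  unfold expFun
  rw [← Complex.exp_conj]
  congr 1
  simp only [map_mul, Complex.conj_I, Complex.conj_ofReal, Complex.ofReal_neg, Complex.conj_ofNat]
  ring

/-- The Fourier transform of `μ₄`. -/
def transform (t : ℝ) : ℂ := ∫ x, expFun t x ∂mu4

theorem coin_real_singleton (c : Bool) : coin.real {c} = 1 / 2 := by
  unfold coin
  rw [measureReal_def, PMF.toMeasure_apply_singleton _ _ (measurableSet_singleton c)]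
  simp

/-- Self-similarity: a `μ₄`-random point is `(a + x) / 4` with `a` uniform on `{0, 2}` and
independent of the `μ₄`-random `x`. -/
theorem transform_eq_mul (t : ℝ) :
    transform t = (1 + Complex.exp ((Real.pi * t : ℝ) * Complex.I)) / 2 * transform (t / 4) := by
  have h1 : ∀ s, transform s =
      ∫ b, expFun s (cantorPoint b) ∂(Measure.infinitePi fun _ : ℕ => coin) := fun s =>
    integral_map measurable_cantorPoint.aemeasurable (continuous_expFun s).aestronglyMeasurable
  have h2 : ∀ c b, expFun t (cantorPoint (consSeq (c, b))) =
      (if c then Complex.exp ((Real.pi * t : ℝ) * Complex.I) else 1) *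
        expFun (t / 4) (cantorPoint b) := by
    intro c b
    rw [cantorPoint_consSeq]
    unfold expFun
    cases c
    · simp only [Bool.false_eq_true, if_false, one_mul]
      congr 1
      push_cast
      ring
    · simp only [if_true]
      rw [← Complex.exp_add]
      congr 1
      push_cast
      ring
  have h3 : ∫ b, expFun t (cantorPoint b) ∂(Measure.infinitePi fun _ : ℕ => coin) =
      ∫ q, expFun t (cantorPoint (consSeq q))
        ∂(coin.prod (Measure.infinitePi fun _ : ℕ => coin)) := by
    conv_lhs => rw [← map_consSeq]
    exact integral_map measurable_consSeq.aemeasurable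
      ((continuous_expFun t).measurable.comp measurable_cantorPoint).aestronglyMeasurable
  have h4 : ∀ q : Bool × (ℕ → Bool), expFun t (cantorPoint (consSeq q)) =
      (if q.1 then Complex.exp ((Real.pi * t : ℝ) * Complex.I) else 1) *
        expFun (t / 4) (cantorPoint q.2) := fun q => h2 q.1 q.2
  rw [h1, h3]
  simp_rw [h4]
  rw [integral_prod_mul (fun c : Bool => if c then
      Complex.exp ((Real.pi * t : ℝ) * Complex.I) else (1 : ℂ))
    (fun b => expFun (t / 4) (cantorPoint b)), ← h1]
  congr 1
  rw [integral_fintype (Integrable.of_finite)]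
  simp [coin_real_singleton]
  ring

/-- The squared absolute value of the Fourier transform of `μ₄`. -/
def intensity (t : ℝ) : ℝ := ‖transform t‖ ^ 2

theorem intensity_eq_mul (t : ℝ) :
    intensity t = Real.cos (Real.pi * t / 2) ^ 2 * intensity (t / 4) := by
  unfold intensity
  rw [transform_eq_mul, norm_mul, mul_pow]
  congr 1
  rw [← Complex.normSq_eq_norm_sq, Complex.normSq_div, Complex.normSq_apply, Real.cos_sq,
    mul_div_cancel₀ _ (two_ne_zero' ℝ), Complex.add_re, Complex.add_im,
    Complex.exp_ofReal_mul_I_re, Complex.exp_ofReal_mul_I_im, Complex.normSq_ofNat,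
    Complex.one_re, Complex.one_im]
  have := Real.sin_sq_add_cos_sq (Real.pi * t)
  linarith

theorem transform_zero : transform 0 = 1 := by
  simp [transform, expFun]

theorem continuous_transform : Continuous transform := by
  refine continuous_of_dominated (bound := fun _ => 1)
    (fun t => (continuous_expFun t).aestronglyMeasurable)
    (fun t => Filter.Eventually.of_forall fun x => (norm_expFun t x).le)
    (integrable_const 1) (Filter.Eventually.of_forall fun x => ?_)
  unfold expFun
  fun_prop

theorem continuous_intensity : Continuous intensity :=
  continuous_transform.norm.pow 2

theorem re_expFun (t x : ℝ) : (expFun t x).re = Real.cos (2 * Real.pi * t * x) := by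
  have h : expFun t x = Complex.exp (((2 * Real.pi * t * x : ℝ) : ℂ) * Complex.I) := by
    unfold expFun
    congr 1
    push_cast
    ring
  rw [h, Complex.exp_ofReal_mul_I_re]

/-- On `[0, 2/3]` the phase `2 π t x` is at most `π / 3` in absolute value, so the integrand has
real part at least `1 / 2`. -/
theorem one_fourth_le_intensity {t : ℝ} (ht : |t| ≤ 1 / 4) : 1 / 4 ≤ intensity t := by
  have h1 : 1 / 2 ≤ (transform t).re := by
    have hre : (transform t).re = ∫ x, (expFun t x).re ∂mu4 :=
      (integral_re (𝕜 := ℂ) (integrable_expFun mu4 t)).symm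
    have hc : ∫ _, (1 / 2 : ℝ) ∂mu4 = 1 / 2 := by simp
    rw [hre, ← hc]
    refine integral_mono_ae (integrable_const _) (integrable_expFun mu4 t).re ?_
    filter_upwards [ae_mem_Icc_mu4] with x hx
    change 1 / 2 ≤ (expFun t x).re
    rw [re_expFun, ← Real.cos_abs, ← Real.cos_pi_div_three]
    have h2 : |2 * Real.pi * t * x| ≤ Real.pi / 3 := by
      rw [abs_mul, abs_mul, abs_of_pos Real.two_pi_pos, abs_of_nonneg hx.1]
      have h3 : |t| * x ≤ 1 / 4 * (2 / 3) := mul_le_mul ht hx.2 hx.1 (by norm_num)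
      nlinarith [Real.pi_pos]
    exact Real.cos_le_cos_of_nonneg_of_le_pi (abs_nonneg _) (by linarith [Real.pi_pos]) h2
  have h2 : 1 / 2 ≤ ‖transform t‖ := h1.trans (Complex.re_le_norm _)
  unfold intensity
  nlinarith

theorem intensity_zero : intensity 0 = 1 := by
  simp [intensity, transform_zero]

theorem inner_expL2 (s t : ℝ) : inner ℂ (expL2 mu4 s) (expL2 mu4 t) = transform (t - s) := by
  rw [L2.inner_def, transform]
  refine integral_congr_ae ?_
  filter_upwards [(memLp_expFun mu4 s).coeFn_toLp, (memLp_expFun mu4 t).coeFn_toLp] with x hs ht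
  unfold expL2
  rw [hs, ht, RCLike.inner_apply, conj_expFun, ← expFun_add, sub_eq_add_neg]

/-! ## Partial products -/

/-- The product of the first `n` factors of `|μ̂₄(t)|²`. -/
def partialIntensity (n : ℕ) (t : ℝ) : ℝ :=
  ∏ k ∈ Finset.range n, Real.cos (Real.pi * (t / 4 ^ k) / 2) ^ 2

theorem partialIntensity_succ (n : ℕ) (t : ℝ) : partialIntensity (n + 1) t =
    partialIntensity n t * Real.cos (Real.pi * (t / 4 ^ n) / 2) ^ 2 :=
  Finset.prod_range_succ _ _

theorem partialIntensity_nonneg (n : ℕ) (t : ℝ) : 0 ≤ partialIntensity n t :=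
  Finset.prod_nonneg fun _ _ => sq_nonneg _

theorem intensity_eq_partialIntensity_mul (n : ℕ) (t : ℝ) :
    intensity t = partialIntensity n t * intensity (t / 4 ^ n) := by
  induction n with
  | zero => simp [partialIntensity]
  | succ n ih =>
    rw [ih, partialIntensity_succ, intensity_eq_mul, mul_assoc, div_div _ _ (4 : ℝ), ← pow_succ]

theorem tendsto_div_four_pow (t : ℝ) :
    Filter.Tendsto (fun n : ℕ => t / 4 ^ n) Filter.atTop (nhds 0) :=
  tendsto_const_nhds.div_atTop (tendsto_pow_atTop_atTop_of_one_lt (by norm_num))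

theorem tendsto_partialIntensity (t : ℝ) :
    Filter.Tendsto (fun n => partialIntensity n t) Filter.atTop (nhds (intensity t)) := by
  have h1 : Filter.Tendsto (fun n : ℕ => intensity (t / 4 ^ n)) Filter.atTop (nhds 1) := by
    rw [← intensity_zero]
    exact (continuous_intensity.tendsto 0).comp (tendsto_div_four_pow t)
  have h2 := (tendsto_const_nhds (x := intensity t)).div h1 one_ne_zero
  rw [div_one] at h2
  refine h2.congr' ?_
  filter_upwards [h1.eventually_ne one_ne_zero] with n hn
  rw [Pi.div_apply, intensity_eq_partialIntensity_mul n t, mul_div_cancel_right₀ _ hn]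

theorem intensity_le_one (t : ℝ) : intensity t ≤ 1 :=
  le_of_tendsto' (tendsto_partialIntensity t) fun _ =>
    Finset.prod_le_one (fun _ _ => sq_nonneg _) fun _ _ => Real.cos_sq_le_one _

theorem cos_sq_add_int_mul_pi (x : ℝ) (q : ℤ) :
    Real.cos (x + q * Real.pi) ^ 2 = Real.cos x ^ 2 := by
  rw [Real.cos_add_int_mul_pi, mul_pow, ← zpow_natCast, ← zpow_mul, mul_comm q, zpow_mul]
  simp

/-- The period is `2 * 4 ^ n`, finer than the obvious `4 ^ (n + 1)`; the completeness estimate needs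
shifts by odd multiples of it. -/
theorem partialIntensity_succ_add (n : ℕ) (t : ℝ) (q : ℤ) :
    partialIntensity (n + 1) (t + 4 ^ n * (2 * q)) = partialIntensity (n + 1) t := by
  refine Finset.prod_congr rfl fun k hk => ?_
  have hk' : k ≤ n := Nat.lt_succ_iff.1 (Finset.mem_range.1 hk)
  rw [← cos_sq_add_int_mul_pi (Real.pi * (t / 4 ^ k) / 2) (4 ^ (n - k) * q)]
  congr 2
  have : (4 : ℝ) ^ n = 4 ^ k * 4 ^ (n - k) := by rw [← pow_add, Nat.add_sub_cancel' hk']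
  rw [this]
  push_cast
  field_simp

theorem partialIntensity_congr {n : ℕ} {a b : ℤ} (h : a ≡ b [ZMOD 4 ^ n]) (t : ℝ) :
    partialIntensity n (t + a) = partialIntensity n (t + b) := by
  cases n with
  | zero => simp [partialIntensity]
  | succ n =>
    obtain ⟨q, hq⟩ := h.dvd
    rw [← partialIntensity_succ_add n (t + a) (2 * q), eq_add_of_sub_eq hq]
    congr 1
    push_cast
    ring

theorem cos_sq_add_cos_sq_of_odd (x : ℝ) {m : ℤ} (hm : Odd m) :
    Real.cos (x + m * (Real.pi / 2)) ^ 2 + Real.cos x ^ 2 = 1 := by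
  obtain ⟨q, rfl⟩ := hm
  have : x + ((2 * q + 1 : ℤ) : ℝ) * (Real.pi / 2) = (x + Real.pi / 2) + q * Real.pi := by
    push_cast
    ring
  rw [this, cos_sq_add_int_mul_pi, Real.cos_add_pi_div_two, neg_sq, Real.sin_sq_add_cos_sq]

/-- Siblings agree in the first `n` factors, while their last arguments differ by an odd multiple of
`π / 2`, so the last factors add up to 1. -/
theorem ParitySeparated.sum_partialIntensity {l : List Bool → Bool → ℤ} (hl : ParitySeparated l)
    (t : ℝ) (n : ℕ) : ∑ v ∈ words n, partialIntensity n (t + value l v) = 1 := by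
  induction n with
  | zero => simp [words, partialIntensity]
  | succ n ih =>
    rw [sum_words_succ, ← ih]
    refine Finset.sum_congr rfl fun v hv => ?_
    have hv' := mem_words.1 hv
    have hmod : ∀ b, value l (v ++ [b]) ≡ value l v [ZMOD 4 ^ n] := fun b =>
      hv' ▸ value_append_modEq l v b
    rw [partialIntensity_succ, partialIntensity_succ, partialIntensity_congr (hmod true),
    partialIntensity_congr (hmod false), ← mul_add]
    have hx : Real.pi * ((t + value l (v ++ [true])) / 4 ^ n) / 2 =
        Real.pi * ((t + value l (v ++ [false])) / 4 ^ n) / 2 +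
          ((l v true - l v false : ℤ) : ℝ) * (Real.pi / 2) := by
      rw [value_append, value_append, hv']
      push_cast
      field_simp
      ring
    rw [hx, cos_sq_add_cos_sq_of_odd _ (hl v), mul_one]

/-! ### Zeros of the Fourier transform -/

theorem exists_int_of_cos_eq_zero {t : ℝ} (h : Real.cos (Real.pi * t / 2) = 0) :
    ∃ m : ℤ, t = m := by
  obtain ⟨k, hk⟩ := Real.cos_eq_zero_iff.1 h
  refine ⟨2 * k + 1, ?_⟩
  have := Real.pi_pos
  have h1 : Real.pi * t = Real.pi * (2 * k + 1) := by linarith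
  push_cast
  exact mul_left_cancel₀ this.ne' h1

theorem intensity_pos_of_ne_int {t : ℝ} (ht : ∀ m : ℤ, t ≠ m) : 0 < intensity t := by
  obtain ⟨n, hn⟩ : ∃ n : ℕ, |t / 4 ^ n| ≤ 1 / 4 := by
    have h1 := (tendsto_div_four_pow t).abs
    rw [abs_zero] at h1
    exact (h1.eventually (ge_mem_nhds (by norm_num : (0 : ℝ) < 1 / 4))).exists
  rw [intensity_eq_partialIntensity_mul n]
  refine mul_pos (Finset.prod_pos fun k _ => ?_)
    ((by norm_num : (0 : ℝ) < 1 / 4).trans_le (one_fourth_le_intensity hn))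
  refine sq_pos_of_ne_zero fun h => ?_
  obtain ⟨m, hm⟩ := exists_int_of_cos_eq_zero h
  refine ht (m * 4 ^ k) ?_
  rw [div_eq_iff (by positivity)] at hm
  rw [hm]
  push_cast
  rfl

theorem transform_eq_zero {j : ℕ} {m : ℤ} (hm : Odd m) :
    transform ((4 ^ j * m : ℤ) : ℝ) = 0 := by
  have h : intensity ((4 ^ j * m : ℤ) : ℝ) = 0 := by
    rw [intensity_eq_partialIntensity_mul (j + 1), partialIntensity_succ]
    have : Real.cos (Real.pi * (((4 ^ j * m : ℤ) : ℝ) / 4 ^ j) / 2) = 0 := by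
      obtain ⟨q, rfl⟩ := hm
      rw [Real.cos_eq_zero_iff]
      refine ⟨q, ?_⟩
      push_cast
      field_simp
    rw [this]
    simp
  simpa [intensity] using h

/-! ## Completeness -/

theorem exists_le_intensity_of_dist (B : ℝ) :
    ∃ δ > 0, ∀ y : ℝ, |y| ≤ B → (∀ m : ℤ, 1 / 4 ≤ |y - m|) → δ ≤ intensity y := by
  have hK : IsCompact {y : ℝ | |y| ≤ B ∧ ∀ m : ℤ, 1 / 4 ≤ |y - m|} := by
    refine Metric.isCompact_of_isClosed_isBounded ?_ ?_
    · have h1 : ∀ m : ℤ, IsClosed {y : ℝ | 1 / 4 ≤ |y - m|} := fun m =>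
        isClosed_le continuous_const (by fun_prop)
      convert (isClosed_le continuous_abs (continuous_const (y := B))).inter
        (isClosed_iInter h1) using 1
      ext y
      simp
    · refine (Metric.isBounded_closedBall (x := (0 : ℝ)) (r := B)).subset fun y hy => ?_
      simpa [Real.dist_eq] using hy.1
  obtain ⟨δ, hδ, h⟩ := hK.exists_forall_le' continuous_intensity.continuousOn (a := 0) (by
    rintro y ⟨-, hy⟩
    refine intensity_pos_of_ne_int fun m hm => ?_
    have := hy m
    rw [hm] at this
    norm_num at this)
  exact ⟨δ, hδ, fun y h1 h2 => h y ⟨h1, h2⟩⟩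

theorem intensity_le_partialIntensity (n : ℕ) (t : ℝ) : intensity t ≤ partialIntensity n t := by
  rw [intensity_eq_partialIntensity_mul n]
  exact mul_le_of_le_one_right (partialIntensity_nonneg n t) (intensity_le_one _)

/-- An integer reached up to level `n` but not a limit is approximated, from level `n` on, by the
value of a word which deviates from it by an odd multiple of `2 * 4 ^ m`. -/
theorem ParitySeparated.exists_value_of_not_mem {l : List Bool → Bool → ℤ}
    (hl : ParitySeparated l) {n : ℕ} {x : ℤ} (hx : Reaches l n x) (h : x ∉ limitIntegers l) :
    ∃ m ≥ n, ∃ w : List Bool, w.length = m + 1 ∧ ∃ q, Odd q ∧ x = value l w + 4 ^ m * (2 * q) := by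
  obtain ⟨m, hm, h1, h2⟩ : ∃ m ≥ n, Reaches l m x ∧ ¬ Reaches l (m + 1) x := by
    by_contra! hc
    refine h (hl.mem_limitIntegers_iff.2 fun k => ?_)
    have : Reaches l (n + k) x := by
      induction k with
      | zero => exact hx
      | succ k ih => exact hc _ (Nat.le_add_right n k) ih
    exact this.of_le (Nat.le_add_left k n)
  obtain ⟨u, rfl, hu⟩ := h1
  obtain ⟨b, q, hq⟩ := hl.exists_append_modEq hu
  refine ⟨u.length, hm, u ++ [b], by simp, q, ?_, hq⟩
  -- For even `q` the word `u ++ [b]` would reach `x` at the next level.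
  rw [← Int.not_even_iff_odd]
  rintro ⟨r, rfl⟩
  refine h2 ⟨u ++ [b], by simp, Int.modEq_iff_dvd.2 ⟨r, ?_⟩⟩
  rw [hq, pow_succ]
  ring

/-- The factor lost beyond level `n` is the intensity at the rescaled point, which can be small only
near an integer `c`. Shifting by `4 ^ n * c` moves that point near 0. If the shifted integer is not
a limit, the word that follows it longest gives a rescaled point near half an odd integer, again far
from the zeros. -/
theorem ParitySeparated.exists_mem_limitIntegers_le {l : List Bool → Bool → ℤ}
    (hl : ParitySeparated l) (h0 : ∀ v, l v false = 0) {C : ℤ}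
    (hC : ∀ v, |value l v| ≤ C * 4 ^ v.length) (t : ℝ) :
    ∃ δ, 0 < δ ∧ δ < 1 ∧ ∀ v, ∃ x ∈ limitIntegers l, x ≡ value l v [ZMOD 4 ^ v.length] ∧
      δ * partialIntensity v.length (t + value l v) ≤ intensity (t + x) := by
  obtain ⟨δ, hδ, hδ'⟩ := exists_le_intensity_of_dist (|t| + C)
  have hB : ∀ v, |(t + value l v) / 4 ^ v.length| ≤ |t| + C := by
    intro v
    have h1 : |(value l v : ℝ)| ≤ C * 4 ^ v.length := by exact_mod_cast hC v
    have h4 : (1 : ℝ) ≤ 4 ^ v.length := one_le_pow₀ (by norm_num)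
    rw [abs_div, abs_of_pos (by positivity : (0 : ℝ) < 4 ^ v.length), div_le_iff₀ (by positivity)]
    nlinarith [abs_add_le t (value l v), abs_nonneg t]
  -- The three cases lose factors `δ`, `1 / 4` and `δ / 4`; the minimum with 1 keeps the constant
  -- below 1.
  refine ⟨min δ 1 / 4, by positivity, by linarith [min_le_right δ 1], fun v => ?_⟩
  have hmin : min δ 1 / 4 ≤ δ := by linarith [min_le_left δ 1]
  have hmin' : min δ 1 / 4 ≤ 1 / 4 := by linarith [min_le_right δ 1]
  set n := v.length with hn
  set y := (t + value l v) / 4 ^ n with hy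
  have hP := partialIntensity_nonneg n (t + value l v)
  by_cases hdist : ∀ m : ℤ, 1 / 4 ≤ |y - m|
  · refine ⟨value l v, hl.value_mem_limitIntegers h0 v, rfl, ?_⟩
    rw [intensity_eq_partialIntensity_mul n, mul_comm]
    exact mul_le_mul_of_nonneg_left (hmin.trans (hδ' y (hB v) hdist)) hP
  · push Not at hdist
    obtain ⟨c, hc⟩ := hdist
    set x := value l v - 4 ^ n * c with hxdef
    have hxv : x ≡ value l v [ZMOD 4 ^ n] := Int.modEq_iff_dvd.2 ⟨c, by rw [hxdef]; ring⟩
    have hyx : (t + x) / 4 ^ n = y - c := by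
      rw [hy, hxdef]
      push_cast
      field_simp
      ring
    have hIx : 1 / 4 * partialIntensity n (t + value l v) ≤ intensity (t + x) := by
      rw [intensity_eq_partialIntensity_mul n (t + x), partialIntensity_congr hxv, hyx, mul_comm]
      exact mul_le_mul_of_nonneg_left (one_fourth_le_intensity hc.le) hP
    by_cases hx : x ∈ limitIntegers l
    · exact ⟨x, hx, hxv, (mul_le_mul_of_nonneg_right hmin' hP).trans hIx⟩
    · obtain ⟨m, hm, w, hw, q, hq, he⟩ :=
        hl.exists_value_of_not_mem ((reaches_value l v).congr hxv.symm) hx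
      refine ⟨value l w, hl.value_mem_limitIntegers h0 w, ?_, ?_⟩
      · refine Int.ModEq.trans (modEq_four_pow_of_le hm ?_) hxv
        exact Int.modEq_iff_dvd.2 ⟨2 * q, by rw [he]; ring⟩
      · have hPw : partialIntensity (m + 1) (t + value l w) = partialIntensity (m + 1) (t + x) := by
          rw [← partialIntensity_succ_add m (t + value l w) q, he]
          push_cast
          rw [add_assoc]
        have hz : (t + value l w) / 4 ^ (m + 1) = (t + x) / 4 ^ (m + 1) - q / 2 := by
          rw [he]
          push_cast
          field_simp
          ring
        have hsmall : |(t + x) / 4 ^ (m + 1)| < 1 / 4 := by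
          refine lt_of_le_of_lt ?_ hc
          rw [← hyx, abs_div, abs_div, abs_of_pos (by positivity : (0 : ℝ) < 4 ^ (m + 1)),
            abs_of_pos (by positivity : (0 : ℝ) < 4 ^ n)]
          exact div_le_div_of_nonneg_left (abs_nonneg _) (by positivity)
            (pow_le_pow_right₀ (by norm_num) (by omega))
        -- With `q` odd, `q / 2` has distance at least `1 / 2` from every integer, and the
        -- perturbation is less than `1 / 4`.
        have hfar : δ ≤ intensity ((t + value l w) / 4 ^ (m + 1)) := by
          refine hδ' _ (hw ▸ hB w) fun k => ?_
          have h1 : (1 : ℝ) ≤ |((q + 2 * k : ℤ) : ℝ)| := by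
            have : Odd (q + 2 * k) := hq.add_even (even_two_mul k)
            have h2 : q + 2 * k ≠ 0 := fun h => by simp [h] at this
            exact_mod_cast Int.one_le_abs h2
          rw [hz]
          push_cast at h1
          rw [abs_lt] at hsmall
          rw [le_abs] at h1 ⊢
          rcases h1 with h1 | h1
          · right; linarith
          · left; linarith
        rw [intensity_eq_partialIntensity_mul (m + 1), hPw]
        have h1 := hIx.trans (intensity_le_partialIntensity (m + 1) (t + x))
        have h2 := mul_le_mul h1 hfar hδ.le (partialIntensity_nonneg _ _)
        refine le_trans ?_ h2
        have := mul_le_mul_of_nonneg_right (min_le_left δ 1) hP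
        linarith

/-- Words whose residues are missed by `F` carry mass at least `1 - ∑ P_n` over `F`; their
representatives are new and recover a proportion `δ` of it. As `n → ∞` the sums of `P_n` over `F`
become sums of intensities. -/
theorem ParitySeparated.exists_lt_sum_intensity {l : List Bool → Bool → ℤ}
    (hl : ParitySeparated l) {t δ : ℝ} (hδ : 0 < δ) (hδ1 : δ < 1)
    (h : ∀ v, ∃ x ∈ limitIntegers l, x ≡ value l v [ZMOD 4 ^ v.length] ∧
      δ * partialIntensity v.length (t + value l v) ≤ intensity (t + x))
    (hb : ∀ F : Finset ℤ, ↑F ⊆ limitIntegers l → ∑ x ∈ F, intensity (t + x) ≤ 1)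
    {r : ℝ} (hr : r < 1) :
    ∃ F : Finset ℤ, ↑F ⊆ limitIntegers l ∧ r < ∑ x ∈ F, intensity (t + x) := by
  classical
  choose g hg hgv hgP using h
  set S : Set ℝ := {s | ∃ F : Finset ℤ, ↑F ⊆ limitIntegers l ∧ s = ∑ x ∈ F, intensity (t + x)}
    with hS
  have hbdd : BddAbove S := ⟨1, by rintro _ ⟨F, hF, rfl⟩; exact hb F hF⟩
  have hne : S.Nonempty := ⟨0, ∅, by simp, by simp⟩
  have step : ∀ (F : Finset ℤ), ↑F ⊆ limitIntegers l → ∀ n,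
      ∑ x ∈ F, intensity (t + x) + δ * (1 - ∑ x ∈ F, partialIntensity n (t + x)) ≤ sSup S := by
    intro F hF n
    set G := (words n).filter fun v => ∃ x ∈ F, x ≡ value l v [ZMOD 4 ^ n] with hG
    set W := (words n).filter fun v => ¬ ∃ x ∈ F, x ≡ value l v [ZMOD 4 ^ n] with hW
    have hinj : Set.InjOn g W := by
      intro u hu v hv huv
      have hu' := mem_words.1 (Finset.mem_filter.1 hu).1
      have hv' := mem_words.1 (Finset.mem_filter.1 hv).1
      have h1 := hgv u
      have h2 := hgv v
      rw [hu'] at h1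
      rw [hv'] at h2
      exact hl.eq_of_modEq hu' hv' (h1.symm.trans (huv ▸ h2))
    have hdisj : Disjoint F (W.image g) := by
      rw [Finset.disjoint_right]
      intro x hx hxF
      obtain ⟨v, hv, rfl⟩ := Finset.mem_image.1 hx
      obtain ⟨hv1, hv2⟩ := Finset.mem_filter.1 hv
      exact hv2 ⟨g v, hxF, mem_words.1 hv1 ▸ hgv v⟩
    have hmem : ∑ x ∈ F ∪ W.image g, intensity (t + x) ∈ S := by
      refine ⟨_, ?_, rfl⟩
      intro x hx
      rcases Finset.mem_union.1 hx with hx | hx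
      · exact hF hx
      · obtain ⟨v, -, rfl⟩ := Finset.mem_image.1 hx
        exact hg v
    refine le_trans ?_ (le_csSup hbdd hmem)
    rw [Finset.sum_union hdisj, Finset.sum_image hinj]
    gcongr
    -- Words in `G` inject into `F` by choosing a congruent element, and `P_n` depends only on the
    -- residue.
    have hGle : ∑ v ∈ G, partialIntensity n (t + value l v) ≤
        ∑ x ∈ F, partialIntensity n (t + x) := by
      have hex : ∀ v, ∃ x, v ∈ G → x ∈ F ∧ x ≡ value l v [ZMOD 4 ^ n] := by
        intro v
        by_cases hv : v ∈ G
        · obtain ⟨x, hx⟩ := (Finset.mem_filter.1 hv).2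
          exact ⟨x, fun _ => hx⟩
        · exact ⟨0, fun h => absurd h hv⟩
      choose k hk using hex
      have hkinj : Set.InjOn k G := by
        intro u hu v hv huv
        exact hl.eq_of_modEq (mem_words.1 (Finset.mem_filter.1 hu).1)
          (mem_words.1 (Finset.mem_filter.1 hv).1)
          ((hk u hu).2.symm.trans (huv ▸ (hk v hv).2))
      calc ∑ v ∈ G, partialIntensity n (t + value l v)
          = ∑ v ∈ G, partialIntensity n (t + k v) :=
            Finset.sum_congr rfl fun v hv => (partialIntensity_congr (hk v hv).2 t).symm
        _ = ∑ x ∈ G.image k, partialIntensity n (t + x) :=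
            (Finset.sum_image (f := fun x : ℤ => partialIntensity n (t + x)) hkinj).symm
        _ ≤ ∑ x ∈ F, partialIntensity n (t + x) := by
            refine Finset.sum_le_sum_of_subset_of_nonneg ?_ fun _ _ _ =>
              partialIntensity_nonneg _ _
            exact Finset.image_subset_iff.2 fun v hv => (hk v hv).1
    have htot := hl.sum_partialIntensity t n
    rw [← Finset.sum_filter_add_sum_filter_not (words n)
      fun v => ∃ x ∈ F, x ≡ value l v [ZMOD 4 ^ n]] at htot
    calc δ * (1 - ∑ x ∈ F, partialIntensity n (t + x))
        ≤ δ * ∑ v ∈ W, partialIntensity n (t + value l v) := by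
          gcongr
          linarith
      _ = ∑ v ∈ W, δ * partialIntensity n (t + value l v) := Finset.mul_sum _ _ _
      _ ≤ ∑ v ∈ W, intensity (t + g v) := by
          refine Finset.sum_le_sum fun v hv => ?_
          have hv' := mem_words.1 (Finset.mem_filter.1 hv).1
          exact hv' ▸ hgP v
  have hlim : ∀ F : Finset ℤ, ↑F ⊆ limitIntegers l →
      ∑ x ∈ F, intensity (t + x) + δ * (1 - ∑ x ∈ F, intensity (t + x)) ≤ sSup S := by
    intro F hF
    refine le_of_tendsto' (x := Filter.atTop) ?_ (step F hF)
    exact tendsto_const_nhds.add ((tendsto_const_nhds.sub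
      (tendsto_finsetSum _ fun x _ => tendsto_partialIntensity _)).const_mul δ)
  -- Taking the supremum of `σ + δ * (1 - σ) ≤ sSup S` over `σ ∈ S` forces `1 ≤ sSup S`.
  have hsup : sSup S ≤ (sSup S - δ) / (1 - δ) := by
    refine csSup_le hne ?_
    rintro _ ⟨F, hF, rfl⟩
    rw [le_div_iff₀ (by linarith)]
    linarith [hlim F hF]
  rw [le_div_iff₀ (by linarith)] at hsup
  have hone : 1 ≤ sSup S := by
    by_contra! hlt
    nlinarith
  obtain ⟨_, ⟨F, hF, rfl⟩, hlt⟩ := exists_lt_of_lt_csSup hne (hr.trans_le hone)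
  exact ⟨F, hF, hlt⟩

/-! ## Density of the integer exponentials -/

theorem measurePreserving_mk_mu4 :
    MeasurePreserving (fun x : ℝ => (x : AddCircle (1 : ℝ))) mu4
      (mu4.map fun x : ℝ => (x : AddCircle (1 : ℝ))) :=
  ⟨(AddCircle.continuous_mk' 1).measurable, rfl⟩

instance : IsProbabilityMeasure (mu4.map fun x : ℝ => (x : AddCircle (1 : ℝ))) :=
  Measure.isProbabilityMeasure_map measurePreserving_mk_mu4.measurable.aemeasurable

/-- The periodic extension of continuous functions on the circle, as elements of `L²(μ₄)`. -/
def periodicL2 : C(AddCircle (1 : ℝ), ℂ) →L[ℂ] Lp ℂ 2 mu4 :=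
  (Lp.compMeasurePreservingₗᵢ ℂ (fun x : ℝ => (x : AddCircle (1 : ℝ)))
    measurePreserving_mk_mu4).toContinuousLinearMap.comp
    (ContinuousMap.toLp 2 (mu4.map fun x : ℝ => (x : AddCircle (1 : ℝ))) ℂ)

theorem coeFn_periodicL2 (g : C(AddCircle (1 : ℝ), ℂ)) :
    periodicL2 g =ᵐ[mu4] fun x : ℝ => g (x : AddCircle (1 : ℝ)) :=
  (Lp.coeFn_compMeasurePreserving _ measurePreserving_mk_mu4).trans
    (measurePreserving_mk_mu4.quasiMeasurePreserving.ae_eq_comp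
      (ContinuousMap.coeFn_toLp (p := 2) (𝕜 := ℂ) _ g))

theorem periodicL2_fourier (k : ℤ) : periodicL2 (fourier k) = expL2 mu4 k := by
  refine Lp.ext ((coeFn_periodicL2 _).trans ?_)
  refine Filter.EventuallyEq.trans ?_ (memLp_expFun mu4 k).coeFn_toLp.symm
  refine Filter.Eventually.of_forall fun x => ?_
  simp [expFun]

theorem denseRange_periodicL2 : DenseRange periodicL2 := by
  refine (BoundedContinuousFunction.toLp_denseRange ℂ mu4 ℂ (p := 2) (by norm_num)).mono ?_
  rintro _ ⟨g, rfl⟩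
  -- Equal to `g` on `[0, 2/3]`, then affine on the gap `[2/3, 1]` back to `g 0`, hence periodic at
  -- no cost in `L²(μ₄)`.
  let h : ℝ → ℂ := fun x => g (min x (2 / 3)) + ((max 0 (3 * x - 2) : ℝ) : ℂ) * (g 0 - g (2 / 3))
  have hcont : Continuous h := by
    have := g.continuous
    fun_prop
  have hper : h 0 = h 1 := by
    have h1 : min (0 : ℝ) (2 / 3) = 0 := by norm_num
    have h2 : min (1 : ℝ) (2 / 3) = 2 / 3 := by norm_num
    have h3 : max (0 : ℝ) (3 * 0 - 2) = 0 := by norm_num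
    have h4 : max (0 : ℝ) (3 * 1 - 2) = 1 := by norm_num
    simp only [h, h1, h2, h3, h4]
    push_cast
    ring
  refine ⟨⟨AddCircle.liftIco 1 0 h, AddCircle.liftIco_zero_continuous hper hcont.continuousOn⟩, ?_⟩
  refine Lp.ext ((coeFn_periodicL2 _).trans ?_)
  refine Filter.EventuallyEq.trans ?_ (BoundedContinuousFunction.coeFn_toLp 2 mu4 ℂ g).symm
  filter_upwards [ae_mem_Icc_mu4] with x hx
  have h1 : min x (2 / 3) = x := min_eq_left hx.2
  have h2 : max 0 (3 * x - 2) = 0 := max_eq_left (by linarith [hx.2])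
  change AddCircle.liftIco 1 0 h (x : AddCircle (1 : ℝ)) = g x
  rw [AddCircle.liftIco_zero_coe_apply ⟨hx.1, by linarith [hx.2]⟩]
  simp only [h, h1, h2]
  simp

theorem span_expL2_int_closure_eq_top :
    (Submodule.span ℂ (Set.range fun k : ℤ => expL2 mu4 k)).topologicalClosure = ⊤ := by
  have h := denseRange_periodicL2.topologicalClosure_map_submodule
    (span_fourier_closure_eq_top (T := 1))
  rw [Submodule.map_span, ← Set.range_comp] at h
  convert h using 4
  ext1 k
  exact (periodicL2_fourier k).symm

/-! ## Spectra -/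

theorem orthogonalExponentials_of_sub {S : Set ℤ}
    (hS : ∀ x ∈ S, ∀ y ∈ S, x ≠ y → ∃ (j : ℕ) (m : ℤ), Odd m ∧ x - y = 4 ^ j * m) :
    OrthogonalExponentials mu4 (((↑) : ℤ → ℝ) '' S) := by
  rintro _ ⟨x, hx, rfl⟩ _ ⟨y, hy, rfl⟩ hxy
  obtain ⟨j, m, hm, he⟩ := hS y hy x hx fun h => hxy (by rw [h])
  rw [inner_expL2, ← Int.cast_sub, he, transform_eq_zero hm]

theorem orthonormal_expL2 {S : Set ℝ} (hS : OrthogonalExponentials mu4 S) :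
    Orthonormal ℂ fun s : S => expL2 mu4 s := by
  refine ⟨fun s => ?_, fun s t hst => hS s.2 t.2 fun h => hst (Subtype.ext h)⟩
  have h1 := inner_self_eq_norm_sq (𝕜 := ℂ) (expL2 mu4 (s : ℝ))
  rw [inner_expL2, sub_self, transform_zero, RCLike.one_re] at h1
  have h2 : ‖expL2 mu4 (s : ℝ)‖ ^ 2 = 1 := h1.symm
  exact (pow_eq_one_iff_of_nonneg (norm_nonneg _) two_ne_zero).1 h2

theorem norm_expL2 (t : ℝ) : ‖expL2 mu4 t‖ = 1 :=
  (orthonormal_expL2 (Set.pairwise_singleton t _)).1 ⟨t, rfl⟩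

/-- A unit vector with Bessel sums close to one lies in the closed span of an orthonormal
family. -/
theorem mem_topologicalClosure_span_of_orthonormal {ι E : Type*} [NormedAddCommGroup E]
    [InnerProductSpace ℂ E] [CompleteSpace E] {v : ι → E} (hv : Orthonormal ℂ v) {x : E}
    (hx : ‖x‖ = 1) (h : ∀ r < 1, ∃ F : Finset ι, r < ∑ i ∈ F, ‖(inner ℂ (v i) x : ℂ)‖ ^ 2) :
    x ∈ (Submodule.span ℂ (Set.range v)).topologicalClosure := by
  set K := (Submodule.span ℂ (Set.range v)).topologicalClosure with hK
  rw [Submodule.mem_iff_norm_starProjection]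
  refine le_antisymm (K.norm_starProjection_apply_le x) ?_
  rw [hx]
  by_contra! hlt
  have hlt2 : ‖K.starProjection x‖ ^ 2 < 1 := by
    have := norm_nonneg (K.starProjection x)
    nlinarith
  obtain ⟨F, hF⟩ := h _ hlt2
  refine hF.not_ge ?_
  -- Projecting `x` to `K` does not change its coefficients, so Bessel's inequality for the
  -- projection bounds the sum.
  refine le_trans (le_of_eq ?_) (hv.sum_inner_products_le (K.starProjection x) (s := F))
  refine Finset.sum_congr rfl fun i _ => ?_
  have hi : v i ∈ K := Submodule.le_topologicalClosure _ (Submodule.subset_span ⟨i, rfl⟩)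
  rw [← K.inner_starProjection_left_eq_right, Submodule.starProjection_eq_self_iff.2 hi]

theorem ParitySeparated.isSpectrum {l : List Bool → Bool → ℤ} (hl : ParitySeparated l)
    (h0 : ∀ v, l v false = 0) {C : ℤ} (hC : ∀ v, |value l v| ≤ C * 4 ^ v.length) :
    IsSpectrum mu4 (((↑) : ℤ → ℝ) '' limitIntegers l) := by
  classical
  have horth : OrthogonalExponentials mu4 (((↑) : ℤ → ℝ) '' limitIntegers l) :=
    orthogonalExponentials_of_sub fun x hx y hy => hl.limitIntegers_sub hx hy
  have hon := orthonormal_expL2 horth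
  let e : limitIntegers l → ((↑) : ℤ → ℝ) '' limitIntegers l := fun x => ⟨x, x, x.2, rfl⟩
  have he : Function.Injective e := fun x y h =>
    Subtype.ext (Int.cast_injective (congrArg Subtype.val h))
  have hon' := hon.comp e he
  have hinner : ∀ (k x : ℤ),
      ‖(inner ℂ (expL2 mu4 x) (expL2 mu4 k) : ℂ)‖ ^ 2 = intensity (-k + x) := by
    intro k x
    rw [← inner_conj_symm, RCLike.norm_conj, inner_expL2, intensity, neg_add_eq_sub]
  have hsum : ∀ (k : ℤ) (F : Finset (limitIntegers l)),
      ∑ x ∈ F, ‖(inner ℂ (expL2 mu4 (x : ℤ)) (expL2 mu4 k) : ℂ)‖ ^ 2 =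
        ∑ x ∈ F.map (Function.Embedding.subtype _), intensity (-k + x) := by
    intro k F
    rw [Finset.sum_map]
    exact Finset.sum_congr rfl fun x _ => hinner k x
  have hlift : ∀ F : Finset ℤ, ↑F ⊆ limitIntegers l →
      ∃ G : Finset (limitIntegers l), G.map (Function.Embedding.subtype _) = F := by
    intro F hF
    refine ⟨F.subtype (· ∈ limitIntegers l), ?_⟩
    rw [Finset.subtype_map, Finset.filter_true_of_mem hF]
  have hmem : ∀ k : ℤ, expL2 mu4 k ∈ (Submodule.span ℂ (Set.range fun s :
      ((↑) : ℤ → ℝ) '' limitIntegers l => expL2 mu4 s)).topologicalClosure := by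
    intro k
    -- At `t = -k` the sums of intensities are the Bessel sums of `e_k`.
    obtain ⟨δ, hδ, hδ1, h⟩ := hl.exists_mem_limitIntegers_le h0 hC (-k)
    have key := mem_topologicalClosure_span_of_orthonormal hon' (norm_expL2 k) fun r hr => by
      obtain ⟨F, hF, hlt⟩ := hl.exists_lt_sum_intensity hδ hδ1 h (fun F hF => by
        obtain ⟨G, rfl⟩ := hlift F hF
        rw [← hsum]
        refine (hon'.sum_inner_products_le (expL2 mu4 k) (s := G)).trans ?_
        rw [norm_expL2, one_pow]) hr
      obtain ⟨G, rfl⟩ := hlift F hF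
      exact ⟨G, hlt.trans_eq (hsum k G).symm⟩
    refine Submodule.topologicalClosure_mono (Submodule.span_mono ?_) key
    exact Set.range_comp_subset_range e _
  have htop : ⊤ ≤ (Submodule.span ℂ (Set.range fun s :
      ((↑) : ℤ → ℝ) '' limitIntegers l => expL2 mu4 s)).topologicalClosure := by
    rw [← span_expL2_int_closure_eq_top]
    refine Submodule.topologicalClosure_minimal _ (Submodule.span_le.2 ?_)
      (Submodule.isClosed_topologicalClosure _)
    rintro _ ⟨k, rfl⟩
    exact hmem k
  exact ⟨HilbertBasis.mk hon htop, fun s => by rw [HilbertBasis.coe_mk]⟩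

end CantorFour

end

theorem theorem4p3 (A : List ℤ → Set ℤ) (hA : CantorFour.IsDigitSystem A) :
    CantorFour.OrthogonalExponentials CantorFour.mu4
        (((↑) : ℤ → ℝ) '' CantorFour.finiteSums A) ∧
      (∃ L : CantorFour.Labeling, CantorFour.IsSpectralLabeling L ∧
        CantorFour.finiteSums A ⊆ L.integers) ∧
      (∀ L L' : CantorFour.Labeling,
        CantorFour.IsSpectralLabeling L → CantorFour.finiteSums A ⊆ L.integers →
        CantorFour.IsSpectralLabeling L' → CantorFour.finiteSums A ⊆ L'.integers →
        L.SameTree L') ∧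
      (∀ L : CantorFour.Labeling,
        CantorFour.IsSpectralLabeling L → CantorFour.finiteSums A ⊆ L.integers →
        L.integers = CantorFour.modifiedIntegers A) ∧
      (CantorFour.UniformlyBounded A → ∀ L : CantorFour.Labeling,
        CantorFour.IsSpectralLabeling L → CantorFour.finiteSums A ⊆ L.integers →
        CantorFour.IsSpectrum CantorFour.mu4 (((↑) : ℤ → ℝ) '' L.integers)) := by
  have hs := CantorFour.paritySeparated_digit A
  have h0 := CantorFour.digit_false A
  refine ⟨?_, hA.exists_labeling, fun L L' hL h hL' h' => hA.sameTree hL h hL' h',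
    fun L hL h => (hA.integers_eq hL h).trans hA.modifiedIntegers_eq.symm, fun hb L hL h => ?_⟩
  · rw [hA.finiteSums_eq]
    refine CantorFour.orthogonalExponentials_of_sub ?_
    rintro _ ⟨u, rfl⟩ _ ⟨v, rfl⟩ hne
    exact hs.limitIntegers_sub (hs.value_mem_limitIntegers h0 u)
      (hs.value_mem_limitIntegers h0 v) hne
  · obtain ⟨C, hC⟩ := hb.abs_value_le hA
    rw [hA.integers_eq hL h]
    exact hs.isSpectrum h0 hC
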